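/- Setting. Let $\mathcal S$ (states) and $\mathcal A$ (actions) be finite non-empty sets, and consider a Markov decision process with transition law $p(s',r\mid s,a)$, rewards bounded by $|r|\le R_{\max}$ almost surely, and discount factor $\gamma\in[0,1)$. Let $Q^*$ be the solution of Bellman's optimality equation $Q^*(s,a)=\mathbb E[\,r+\gamma\max_{a'}Q^*(s',a')\mid s,a]$. Let $\mathcal T$ be a map on $\mathcal S$ such that states with the same image are equivalent: if $\mathcal T(s)=\mathcal T(\tilde s)$, then for every action $a$ we have $p(s'\mid s,a)=p(s'\mid\tilde s,a)$ for all $s'$, and a reward distributed as the reward of $(\tilde s,a)$ can be computed (measurably) from a transition observed at $(s,a)$. Let $|\widetilde{\mathcal H}|$ be the (largest) number of state-action pairs $(\tilde s,a)$ with a common value of $\mathcal T(\tilde s)$ and a common action $a$. Asynchronous Q-learning with virtual experience: in each iteration $t=1,2,\dots$ an action $a$ is performed in the current state $s$ (chosen in any, possibly random and history-dependent, way), a reward and a next state $s'$ are observed, and simultaneously for all $\tilde s$ with $\mathcal T(\tilde s)=\mathcal T(s)$ $$Q(\tilde s,a)\leftarrow(1-\alpha)Q(\tilde s,a)+\alpha\bigl[\tilde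 r+\gamma\max_{a'}Q(s',a')\bigr],$$ where $\tilde r$ is the reward derived for $(\tilde s,a)$ (the observed reward if $\tilde s=s$); all these pairs are said to be visited. The learning rate is polynomial, $\alpha=1/n^{\phi}$ with $\phi\in(1/2,1)$, where $n$ is either the number $t$ of the iteration or the number of updates of the pair concerned so far, the current one included. The initial table satisfies $|Q_0|\le q$. Write $Q_\tau$ for the table after $\tau$ iterations. Claim. Let $\varepsilon>0$, $\delta_0<1$ and $p_0<1$. There is a constant $C>0$, depending only on $\mathcal S,\mathcal A,\phi,\gamma,\varepsilon,R_{\max},q,\delta_0,p_0$, with the following property for every such process, map $\mathcal T$, way of choosing actions and initial table. Let $L\in\mathbb N$ and $P>0$ with $|\widetilde{\mathcal H}|P\le p_0$ be such that at any time, whatever has happened so far, all state-action pairs are visited (with virtual experience) within the next $L$ iterations with conditional probability at least $|\widetilde{\mathcal H}|P$. Then for every $0<\delta\le\delta_0$ and every $\tau\in\mathbb N$ with $$\tau\ \ge\ C\left[\Bigl(L\,\frac{\log_2\delta}{\log_2(1-|\widetilde{\mathcal H}|P)}\Bigr)^{3+1/\phi}+\Bigl(L\,\frac{\log_2\delta}{\log_2(1-|\widetilde{\mathcal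 H}|P)}\Bigr)^{1/(1-\phi)}\right]$$ we have $\|Q_\tau-Q^*\|_\infty\le\varepsilon$ with probability at least $1-\delta$. -/

import Mathlib

open MeasureTheory

namespace VirtualQ

/-- A Markov decision process with states `S`, actions `A` and random real rewards:
`law s a` is the joint law `p(s', r | s, a)` of the next state and the immediate reward. -/
structure RewardMDP (S A : Type*) [MeasurableSpace S] where
  law : S → A → Measure (S × ℝ)
  isProb : ∀ s a, IsProbabilityMeasure (law s a)

/-- The largest entry `max_{a'} Q(s, a')` of the row `s` of a Q-table. -/
noncomputable def rowMax {S A : Type*} [Fintype A] [Nonempty A] (Q : S → A → ℝ) (s : S) : ℝ :=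
  Finset.univ.sup' Finset.univ_nonempty (Q s)

/-- Bellman's optimality equation
`Q(s,a) = E[R_{t+1} + γ max_{a'} Q(S_{t+1}, a') | S_t = s, A_t = a]`, which defines `Q^*`. -/
def IsOptimalQ {S A : Type*} [MeasurableSpace S] [Fintype A] [Nonempty A]
    (M : RewardMDP S A) (γ : ℝ) (Q : S → A → ℝ) : Prop :=
  ∀ s a, Q s a = ∫ x, (x.2 + γ * rowMax Q x.1) ∂(M.law s a)

theorem abs_rowMax_sub_le {S A : Type*} [Fintype S] [Fintype A] [Nonempty A]
    (Q Q' : S → A → ℝ) (s : S) : |rowMax Q s - rowMax Q' s| ≤ ‖Q - Q'‖ := by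
  have key : ∀ V W : S → A → ℝ, rowMax V s - rowMax W s ≤ ‖V - W‖ := by
    intro V W
    rw [sub_le_iff_le_add]
    refine Finset.sup'_le _ _ fun a _ => ?_
    have h1 : W s a ≤ rowMax W s := Finset.le_sup' (W s) (Finset.mem_univ a)
    have h2 : |V s a - W s a| ≤ ‖V - W‖ :=
      (norm_le_pi_norm ((V - W) s) a).trans (norm_le_pi_norm (V - W) s)
    have h3 := le_abs_self (V s a - W s a)
    linarith
  rw [abs_le]
  have h := key Q' Q
  rw [norm_sub_rev] at h
  exact ⟨by linarith, key Q Q'⟩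

/-- `Q^*` exists and is unique. -/
theorem existsUnique_isOptimalQ {S A : Type*} [Fintype S] [MeasurableSpace S]
    [MeasurableSingletonClass S] [Fintype A] [Nonempty A] (M : RewardMDP S A) {γ : ℝ}
    (h0 : 0 ≤ γ) (h1 : γ < 1) (hr : ∀ s a, Integrable (fun x : S × ℝ => x.2) (M.law s a)) :
    ∃! Q : S → A → ℝ, IsOptimalQ M γ Q := by
  have hp := M.isProb
  let F : (S → A → ℝ) → (S → A → ℝ) := fun Q s a => ∫ x, (x.2 + γ * rowMax Q x.1) ∂(M.law s a)
  have hint : ∀ (Q : S → A → ℝ) s a,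
      Integrable (fun x : S × ℝ => γ * rowMax Q x.1) (M.law s a) := by
    intro Q s a
    have hm : Measurable fun x : S × ℝ => rowMax Q x.1 :=
      (measurable_of_finite (rowMax Q)).comp measurable_fst
    refine Integrable.const_mul ?_ γ
    refine Integrable.of_bound hm.aestronglyMeasurable ‖Q‖ (Filter.Eventually.of_forall fun x => ?_)
    obtain ⟨b, -, hb⟩ := Finset.exists_mem_eq_sup' (Finset.univ_nonempty (α := A)) (Q x.1)
    have : rowMax Q x.1 = Q x.1 b := hb
    rw [this]
    exact (norm_le_pi_norm (Q x.1) b).trans (norm_le_pi_norm Q x.1)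
  have hF : ContractingWith ⟨γ, h0⟩ F := by
    refine ⟨by exact_mod_cast h1, LipschitzWith.of_dist_le_mul fun Q Q' => ?_⟩
    rw [dist_eq_norm, dist_eq_norm]
    have hnn : 0 ≤ γ * ‖Q - Q'‖ := by positivity
    change ‖F Q - F Q'‖ ≤ γ * ‖Q - Q'‖
    refine (pi_norm_le_iff_of_nonneg hnn).2 fun s => (pi_norm_le_iff_of_nonneg hnn).2 fun a => ?_
    have e : (F Q - F Q') s a
        = ∫ x, (γ * rowMax Q x.1 - γ * rowMax Q' x.1) ∂(M.law s a) := by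
      change (∫ x, (x.2 + γ * rowMax Q x.1) ∂(M.law s a))
        - (∫ x, (x.2 + γ * rowMax Q' x.1) ∂(M.law s a)) = _
      rw [integral_add (hr s a) (hint Q s a), integral_add (hr s a) (hint Q' s a),
        integral_sub (hint Q s a) (hint Q' s a)]
      ring
    rw [e]
    refine (norm_integral_le_of_norm_le_const (C := γ * ‖Q - Q'‖)
      (Filter.Eventually.of_forall fun x => ?_)).trans (by simp)
    rw [← mul_sub, norm_mul, Real.norm_of_nonneg h0]
    exact mul_le_mul_of_nonneg_left (abs_rowMax_sub_le Q Q' x.1) h0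
  refine ⟨hF.fixedPoint F, fun s a => ?_, fun Q hQ => hF.fixedPoint_unique ?_⟩
  · exact (congrFun (congrFun hF.fixedPoint_isFixedPt s) a).symm
  · exact (funext fun s => funext fun a => hQ s a).symm

/-- Virtual experience on `M`: a transformation `T` of the states such that states with the same
image are equivalent, i.e. under any common action they have the same next-state
probabilities, and the reward of one can be derived from the transition observed at another:
`derive s σ a s' r` is the reward credited to `(σ, a)` when the transition from `(s, a)` to `s'`
with reward `r` was observed, and it is distributed as the reward of `(σ, a)`. -/
structure VirtualExperience {S A : Type*} [MeasurableSpace S] (M : RewardMDP S A)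
    (Z : Type*) where
  T : S → Z
  derive : S → S → A → S → ℝ → ℝ
  derive_self : ∀ s a s' r, derive s s a s' r = r
  measurable_derive : ∀ s σ a, Measurable fun x : S × ℝ => derive s σ a x.1 x.2
  nextState_eq : ∀ s σ a, T s = T σ → (M.law s a).map Prod.fst = (M.law σ a).map Prod.fst
  reward_eq : ∀ s σ a, T s = T σ →
    (M.law s a).map (fun x => derive s σ a x.1 x.2) = (M.law σ a).map Prod.snd

/-- The batch size `|H̃|`: the (largest) number of state-action pairs that are updated in one
iteration, i.e. of states that share their image under `T`. -/
noncomputable def batchSize {S Z : Type*} [Fintype S] (T : S → Z) : ℕ :=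
  Finset.univ.sup fun s => Nat.card {σ : S // T σ = T s}

/-- The pair `(σ, a)` is updated (really or virtually visited) when action `b` is
performed in state `x`. -/
def Updated {S A Z : Type*} (T : S → Z) (x : S) (b : A) (σ : S) (a : A) : Prop :=
  T σ = T x ∧ a = b

/-- The two usual clocks for the polynomial learning rate `1 / n ^ φ`: `n` is the number of the
current iteration, or the number of updates of the pair concerned, the current one included. -/
inductive Clock where
  | iterations
  | updates

open Classical in
/-- The number `n` in the learning rate `1 / n ^ φ` used for `(σ, a)` in iteration `t` (iterations
are numbered from `0`), along the path of states `x` and actions `u`. -/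
noncomputable def clockValue {S A Z : Type*} (T : S → Z) (x : ℕ → S) (u : ℕ → A) :
    Clock → ℕ → S → A → ℕ
  | .iterations, t, _, _ => t + 1
  | .updates, t, σ, a => ((Finset.range t).filter fun k => Updated T (x k) (u k) σ a).card + 1

/-- The polynomial learning rate. -/
noncomputable def learningRate {S A Z : Type*} (T : S → Z) (x : ℕ → S) (u : ℕ → A)
    (c : Clock) (φ : ℝ) (t : ℕ) (σ : S) (a : A) : ℝ :=
  1 / (clockValue T x u c t σ a : ℝ) ^ φ

open Classical in
/-- Asynchronous Q-learning with virtual experience along the path of states `x`, actions `u` and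
rewards `r` (in iteration `t`, action `u t` is performed in state `x t`, and reward `r t` and
state `x (t + 1)` are observed), started from the table `Q₀`. In each iteration all pairs equivalent
to the visited one are updated, with the observed next state and their derived rewards. -/
noncomputable def qTable {S A Z : Type*} [MeasurableSpace S] [Fintype A] [Nonempty A]
    {M : RewardMDP S A} (V : VirtualExperience M Z) (c : Clock) (φ γ : ℝ) (Q₀ : S → A → ℝ)
    (x : ℕ → S) (u : ℕ → A) (r : ℕ → ℝ) : ℕ → S → A → ℝ
  | 0 => Q₀
  | t + 1 => fun σ a =>
      let Q := qTable V c φ γ Q₀ x u r t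
      let α := learningRate V.T x u c φ t σ a
      if Updated V.T (x t) (u t) σ a then
        (1 - α) * Q σ a
          + α * (V.derive (x t) σ a (x (t + 1)) (r t) + γ * rowMax Q (x (t + 1)))
      else Q σ a

/-- `X`, `U`, `R` are the states, actions and rewards of the process `M` under some, possibly
randomized and history-dependent, way of choosing actions; `ℱ t` is the information
available just before action `U t` is chosen. -/
structure IsTrajectory {S A Ω : Type*} [MeasurableSpace S] [MeasurableSpace A]
    [mΩ : MeasurableSpace Ω] (M : RewardMDP S A) (μ : Measure Ω) (ℱ : Filtration ℕ mΩ)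
    (X : ℕ → Ω → S) (U : ℕ → Ω → A) (R : ℕ → Ω → ℝ) : Prop where
  measurable_state : ∀ t, Measurable[ℱ t] (X t)
  measurable_action : ∀ t, Measurable[ℱ (t + 1)] (U t)
  measurable_reward : ∀ t, Measurable[ℱ (t + 1)] (R t)
  /-- Given the past and `X t = s`, `U t = a`, the pair `(X (t+1), R t)` has law `M.law s a`. -/
  transition : ∀ t s a (E : Set Ω) (D : Set (S × ℝ)), MeasurableSet[ℱ t] E → MeasurableSet D →
    μ (E ∩ {ω | X t ω = s ∧ U t ω = a ∧ (X (t + 1) ω, R t ω) ∈ D})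
      = μ (E ∩ {ω | X t ω = s ∧ U t ω = a}) * M.law s a D

/-- The event that all state-action pairs are visited, really or virtually, in the `L` iterations
from time `t` on. -/
def coverEvent {S A Z Ω : Type*} (T : S → Z) (X : ℕ → Ω → S) (U : ℕ → Ω → A) (t L : ℕ) : Set Ω :=
  {ω | ∀ σ a, ∃ k, t ≤ k ∧ k < t + L ∧ Updated T (X k ω) (U k ω) σ a}

/-- At any time and whatever has happened so far, all state-action pairs are visited, really or
virtually, in the next `L` iterations with conditional probability at least `p`. -/
def CoversWithProb {S A Z Ω : Type*} [mΩ : MeasurableSpace Ω] (T : S → Z) (μ : Measure Ω)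
    (ℱ : Filtration ℕ mΩ) (X : ℕ → Ω → S) (U : ℕ → Ω → A) (L : ℕ) (p : ℝ) : Prop :=
  ∀ t (E : Set Ω), MeasurableSet[ℱ t] E → ENNReal.ofReal p * μ E ≤ μ (E ∩ coverEvent T X U t L)

/-- The covering time `L · log₂ δ / log₂ (1 - p)`. -/
noncomputable def coveringTime (L : ℕ) (δ p : ℝ) : ℝ :=
  L * (Real.logb 2 δ / Real.logb 2 (1 - p))

end VirtualQ

/-!
The error `e = Q - Q^*` of the table obeys, in an update of the pair `(σ, a)` with learning rate `α`,
`e ← (1 - α) e + α (γ d + w)`, where `d` is a difference of row maxima, so that `|d| ≤ ‖e‖`, and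
where the noise `w` (`noiseTerm`) is the deviation of the sampled Bellman target of `Q^*` itself.
Given the past, `w` is bounded and centred, also for virtual visits (`integral_noiseTerm`). Let `Z`
be the average of the noise formed with the same learning rates (`noiseAvg`). Then `Y = e - Z` obeys
the same recursion without noise, and hence it is contracted as long as `Z` is small.

*The noise.* Let `α₀` bound the learning rates. By Hoeffding's lemma, an update turns the
exponential moment `W = exp (θ Z)` into at most `W ^ (1 - α) * exp (v * α)` with `v` of the order
`θ² α₀`, and this weighted geometric mean is at most `W + exp v`. So after `t` iterations the
expectation of `W` is at most `(t + 1) exp v`, and `θ` of the order `η / α₀` gives `|Z| < η` up to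
probability `2 (t + 1) exp (- c / α₀)` (`IsTrajectory.measure_le_abs_noiseAvg`). To have the bound
`α₀` from the beginning, larger learning rates are replaced by zero in the definition of `Z`.

*The visits.* Divide the iterations into consecutive blocks of length `L`, and let `p` be the lower
bound on the conditional probability that all pairs are updated in a block. The expectation of
`2 ^ (-k)`, with `k` the number of blocks among the first `n` in which this happens, is at most
`(1 - p / 2) ^ n`, so `k ≥ n p / 4` up to probability `exp (- n p / 4)`
(`CoversWithProb.measure_coverCount_lt`).

*The contraction.* Only a bounded number of phases, each taking a fixed fraction of the time `τ`, is
needed. In the first one all learning rates fall below `α₀ = N ^ (-φ)`, where `N` is of the order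
`τ p / L`; in each later one the learning rates of each pair add up to at least `N τ ^ (-φ)`, which
is large because `τ ^ (1 - φ)` dominates the covering time, and so `Y` shrinks by a fixed factor up
to a multiple of `η` (`norm_qTable_sub_le_of_path`). The other term of the lower bound on `τ` makes
`1 / α₀ = N ^ φ` dominate `log (1 / δ) + 2 log (τ + 1)`, as the union bound over time requires
(`exists_const_covering`).
-/

namespace VirtualQ

open scoped ENNReal

/-! ### Freezing the past -/

section Freezing

variable {S A Ω : Type*} [MeasurableSpace S] [MeasurableSpace A] [mΩ : MeasurableSpace Ω]
  {M : RewardMDP S A} {μ : Measure Ω} {ℱ : Filtration ℕ mΩ}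
  {X : ℕ → Ω → S} {U : ℕ → Ω → A} {R : ℕ → Ω → ℝ}

theorem IsTrajectory.measurableSet_pair
    [Fintype S] [MeasurableSingletonClass S] [Fintype A] [MeasurableSingletonClass A]
    (h : IsTrajectory M μ ℱ X U R) (t : ℕ)
    (p : S → A → Prop) : MeasurableSet[ℱ (t + 1)] {ω | p (X t ω) (U t ω)} := by
  have hm : Measurable[ℱ (t + 1)] fun ω => (X t ω, U t ω) :=
    ((h.measurable_state t).mono (ℱ.mono t.le_succ) le_rfl).prodMk (h.measurable_action t)
  exact hm (Set.toFinite {y : S × A | p y.1 y.2}).measurableSet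

theorem IsTrajectory.measurable_outcome (h : IsTrajectory M μ ℱ X U R) (t : ℕ) :
    Measurable[ℱ (t + 1)] fun ω => (X (t + 1) ω, R t ω) :=
  (h.measurable_state (t + 1)).prodMk (h.measurable_reward t)

/-- On the event that action `a` is performed in state `s`, the outcome of the transition is
independent of everything known before, so the past can be frozen while integrating it out. -/
theorem IsTrajectory.lintegral_transition [IsProbabilityMeasure μ]
    [Fintype S] [MeasurableSingletonClass S] [Fintype A] [MeasurableSingletonClass A]
    (h : IsTrajectory M μ ℱ X U R) (t : ℕ) (s : S) (a : A)
    {β : Type*} [MeasurableSpace β] {Y : Ω → β} (hY : Measurable[ℱ t] Y)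
    {f : β × (S × ℝ) → ℝ≥0∞} (hf : Measurable f) :
    ∫⁻ ω in {ω | X t ω = s ∧ U t ω = a}, f (Y ω, (X (t + 1) ω, R t ω)) ∂μ
      = ∫⁻ ω in {ω | X t ω = s ∧ U t ω = a}, ∫⁻ y, f (Y ω, y) ∂(M.law s a) ∂μ := by
  have := M.isProb s a
  have hY' : Measurable Y := hY.mono (ℱ.le t) le_rfl
  have ho : Measurable fun ω => (X (t + 1) ω, R t ω) :=
    (h.measurable_outcome t).mono (ℱ.le _) le_rfl
  set B : Set Ω := {ω | X t ω = s ∧ U t ω = a} with hB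
  have hBm : MeasurableSet B :=
    ℱ.le _ _ (h.measurableSet_pair t fun s' a' => s' = s ∧ a' = a)
  have key : ((μ.restrict B).map Y).prod (M.law s a)
      = (μ.restrict B).map fun ω => (Y ω, (X (t + 1) ω, R t ω)) := by
    refine Measure.prod_eq fun E D hE hD => ?_
    rw [Measure.map_apply (hY'.prodMk ho) (hE.prod hD), Measure.map_apply hY' hE,
      Measure.restrict_apply ((hY'.prodMk ho) (hE.prod hD)), Measure.restrict_apply (hY' hE),
      ← h.transition t s a (Y ⁻¹' E) D (hY hE) hD]
    congr 1
    ext ω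
    simp only [hB, Set.mem_inter_iff, Set.mem_preimage, Set.mem_prod, Set.mem_ofPred_eq]
    tauto
  rw [← lintegral_map (f := f) hf (hY'.prodMk ho), ← key, lintegral_prod _ hf.aemeasurable,
    lintegral_map hf.lintegral_prod_right' hY']

/-- A property that holds almost surely under every transition law holds almost surely along the
trajectory. -/
theorem IsTrajectory.ae_outcome [Fintype S] [Fintype A] (h : IsTrajectory M μ ℱ X U R)
    {p : S → A → S × ℝ → Prop} (hm : ∀ s a, MeasurableSet {y | p s a y})
    (hp : ∀ s a, ∀ᵐ y ∂(M.law s a), p s a y) :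
    ∀ᵐ ω ∂μ, ∀ t, p (X t ω) (U t ω) (X (t + 1) ω, R t ω) := by
  rw [ae_all_iff]
  intro t
  have hsa : ∀ s a, ∀ᵐ ω ∂μ, X t ω = s → U t ω = a → p s a (X (t + 1) ω, R t ω) := by
    intro s a
    have h0 := h.transition t s a Set.univ {y | p s a y}ᶜ MeasurableSet.univ (hm s a).compl
    have h1 : M.law s a {y | p s a y}ᶜ = 0 := hp s a
    rw [h1, mul_zero, Set.univ_inter] at h0
    rw [ae_iff]
    refine measure_mono_null (fun ω hω => ?_) h0
    simpa only [Set.mem_ofPred_eq, Classical.not_imp, Set.mem_compl_iff] using hω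
  have := (ae_all_iff.2 fun s => ae_all_iff.2 (hsa s))
  filter_upwards [this] with ω hω using hω _ _ rfl rfl

end Freezing

/-! ### The averaged noise -/

theorem abs_rowMax_le {S A : Type*} [Fintype S] [Fintype A] [Nonempty A] (Q : S → A → ℝ) (s : S) : |rowMax Q s| ≤ ‖Q‖ := by
  have h := abs_rowMax_sub_le Q 0 s
  have h0 : rowMax (0 : S → A → ℝ) s = 0 := by simp [rowMax]
  simpa [h0] using h

/-- Hoeffding's lemma for a centred variable with values in `[-c, c]`. -/
theorem lintegral_exp_mul_le {Y : Type*} [MeasurableSpace Y] {ν : Measure Y}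
    [IsProbabilityMeasure ν] {f : Y → ℝ} (hf : Measurable f) {c : ℝ} (hc : 0 ≤ c)
    (hb : ∀ᵐ y ∂ν, |f y| ≤ c) (h0 : ∫ y, f y ∂ν = 0) (v : ℝ) :
    ∫⁻ y, ENNReal.ofReal (Real.exp (v * f y)) ∂ν
      ≤ ENNReal.ofReal (Real.exp (v ^ 2 * c ^ 2 / 2)) := by
  have hs := ProbabilityTheory.hasSubgaussianMGF_of_mem_Icc_of_integral_eq_zero (μ := ν)
    (a := -c) (b := c) hf.aemeasurable (hb.mono fun y hy => abs_le.1 hy) h0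
  rw [← ofReal_integral_eq_lintegral_ofReal (hs.integrable_exp_mul v)
    (Filter.Eventually.of_forall fun y => (Real.exp_pos _).le)]
  refine ENNReal.ofReal_le_ofReal ((hs.mgf_le v).trans (le_of_eq ?_))
  congr 1
  have : (((‖c - -c‖₊ / 2) ^ 2 : NNReal) : ℝ) = c ^ 2 := by
    push_cast
    rw [Real.norm_of_nonneg (by linarith)]
    ring
  rw [this]
  ring

section Noise

variable {S A Z : Type*} [MeasurableSpace S] [Fintype A] [Nonempty A] {M : RewardMDP S A}

/-- The noise in the update of `(σ, a)` after a transition from `(s, a)` with outcome `y`: the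
deviation of the sampled Bellman target of `Qs` from `Qs σ a`. Unlike the sampled target of the
current table, it depends on the past only through `s`. -/
noncomputable def noiseTerm (V : VirtualExperience M Z) (γ : ℝ) (Qs : S → A → ℝ) (s σ : S) (a : A)
    (y : S × ℝ) : ℝ :=
  V.derive s σ a y.1 y.2 + γ * rowMax Qs y.1 - Qs σ a

/-- The learning rate, switched off as long as it exceeds `α₀`. -/
noncomputable def cutRate (T : S → Z) (c : Clock) (φ α₀ : ℝ) (x : ℕ → S) (u : ℕ → A)
    (t : ℕ) (σ : S) (a : A) : ℝ :=
  if learningRate T x u c φ t σ a ≤ α₀ then learningRate T x u c φ t σ a else 0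

open Classical in
/-- The weighted average of the noise, formed like the entries of the Q-table but with the learning
rate replaced by `cutRate` and started from zero. -/
noncomputable def noiseAvg (V : VirtualExperience M Z) (c : Clock) (φ γ α₀ : ℝ) (Qs : S → A → ℝ)
    (x : ℕ → S) (u : ℕ → A) (r : ℕ → ℝ) : ℕ → S → A → ℝ
  | 0 => 0
  | t + 1 => fun σ a =>
      let g := cutRate V.T c φ α₀ x u t σ a
      if Updated V.T (x t) (u t) σ a then
        (1 - g) * noiseAvg V c φ γ α₀ Qs x u r t σ a
          + g * noiseTerm V γ Qs (x t) σ a (x (t + 1), r t)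
      else noiseAvg V c φ γ α₀ Qs x u r t σ a

end Noise

section Rate

variable {S A Z : Type*}

theorem one_le_clockValue (T : S → Z) (x : ℕ → S) (u : ℕ → A) (c : Clock) (t : ℕ) (σ : S)
    (a : A) : 1 ≤ clockValue T x u c t σ a := by
  cases c <;> simp [clockValue]

theorem clockValue_le (T : S → Z) (x : ℕ → S) (u : ℕ → A) (c : Clock) (t : ℕ) (σ : S)
    (a : A) : clockValue T x u c t σ a ≤ t + 1 := by
  classical
  cases c
  · simp [clockValue]
  · simp only [clockValue, add_le_add_iff_right]
    exact (Finset.card_filter_le _ _).trans (by simp)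

open Classical in
theorem card_updated_lt_clockValue (T : S → Z) (x : ℕ → S) (u : ℕ → A) (c : Clock) (t : ℕ) (σ : S)
    (a : A) : ((Finset.range t).filter fun k => Updated T (x k) (u k) σ a).card
      < clockValue T x u c t σ a := by
  cases c
  · exact Nat.lt_succ_of_le ((Finset.card_filter_le _ _).trans (by simp))
  · simp [clockValue]

theorem learningRate_pos (T : S → Z) (x : ℕ → S) (u : ℕ → A) (c : Clock) (φ : ℝ) (t : ℕ) (σ : S)
    (a : A) : 0 < learningRate T x u c φ t σ a := by
  have : (0 : ℝ) < clockValue T x u c t σ a := by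
    exact_mod_cast one_le_clockValue T x u c t σ a
  unfold learningRate
  positivity

theorem learningRate_le_one (T : S → Z) (x : ℕ → S) (u : ℕ → A) (c : Clock) {φ : ℝ} (hφ : 0 ≤ φ)
    (t : ℕ) (σ : S) (a : A) : learningRate T x u c φ t σ a ≤ 1 := by
  have : (1 : ℝ) ≤ clockValue T x u c t σ a := by
    exact_mod_cast one_le_clockValue T x u c t σ a
  exact div_le_one_of_le₀ (Real.one_le_rpow this hφ) (by positivity)

/-- Up to time `τ`, the learning rate is at least what it would be if the pair had been updated in
every iteration. -/
theorem le_learningRate (T : S → Z) (x : ℕ → S) (u : ℕ → A) (c : Clock) {φ : ℝ} (hφ : 0 ≤ φ)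
    {t τ : ℕ} (ht : t < τ) (σ : S) (a : A) :
    1 / (τ : ℝ) ^ φ ≤ learningRate T x u c φ t σ a := by
  have h1 : (1 : ℝ) ≤ clockValue T x u c t σ a := by
    exact_mod_cast one_le_clockValue T x u c t σ a
  have h2 : (clockValue T x u c t σ a : ℝ) ≤ τ := by
    exact_mod_cast (clockValue_le T x u c t σ a).trans ht
  exact one_div_le_one_div_of_le (by positivity) (Real.rpow_le_rpow (by linarith) h2 hφ)

open Classical in
/-- With both clocks, the learning rate is small once the pair has been updated often. -/
theorem learningRate_le (T : S → Z) (x : ℕ → S) (u : ℕ → A) (c : Clock) {φ : ℝ} (hφ : 0 ≤ φ)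
    {t : ℕ} (σ : S) (a : A) {N : ℝ} (hN : 0 < N)
    (h : N ≤ ((Finset.range t).filter fun k => Updated T (x k) (u k) σ a).card) :
    learningRate T x u c φ t σ a ≤ 1 / N ^ φ := by
  have h2 : N ≤ clockValue T x u c t σ a :=
    h.trans (by exact_mod_cast (card_updated_lt_clockValue T x u c t σ a).le)
  exact one_div_le_one_div_of_le (by positivity) (Real.rpow_le_rpow hN.le h2 hφ)

theorem cutRate_nonneg (T : S → Z) (x : ℕ → S) (u : ℕ → A) (c : Clock) (φ α₀ : ℝ)
    (t : ℕ) (σ : S) (a : A) : 0 ≤ cutRate T c φ α₀ x u t σ a := by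
  unfold cutRate
  split_ifs
  exacts [(learningRate_pos T x u c φ t σ a).le, le_rfl]

theorem cutRate_le_one (T : S → Z) (x : ℕ → S) (u : ℕ → A) (c : Clock) {φ : ℝ} (hφ : 0 ≤ φ)
    (α₀ : ℝ) (t : ℕ) (σ : S) (a : A) : cutRate T c φ α₀ x u t σ a ≤ 1 := by
  unfold cutRate
  split_ifs
  exacts [learningRate_le_one T x u c hφ t σ a, zero_le_one]

theorem cutRate_le (T : S → Z) (x : ℕ → S) (u : ℕ → A) (c : Clock) (φ : ℝ) {α₀ : ℝ}
    (h0 : 0 ≤ α₀) (t : ℕ) (σ : S) (a : A) : cutRate T c φ α₀ x u t σ a ≤ α₀ := by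
  unfold cutRate
  split_ifs with h
  exacts [h, h0]

end Rate

section NoiseTerm

variable {S A Z : Type*} [Fintype S] [MeasurableSpace S] [Fintype A] [Nonempty A]
  {M : RewardMDP S A}

theorem measurable_noiseTerm [MeasurableSingletonClass S] (V : VirtualExperience M Z) (γ : ℝ) (Qs : S → A → ℝ) (s σ : S)
    (a : A) : Measurable (noiseTerm V γ Qs s σ a) := by
  have h1 : Measurable fun x : S × ℝ => rowMax Qs x.1 :=
    (measurable_of_finite (rowMax Qs)).comp measurable_fst
  exact ((V.measurable_derive s σ a).add (h1.const_mul γ)).sub_const _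

/-- The noise is centred, also for virtual visits: equivalent pairs have the same next-state
probabilities, and derived rewards have the right distribution. -/
theorem integral_noiseTerm [MeasurableSingletonClass S] (V : VirtualExperience M Z) {γ : ℝ} {Qs : S → A → ℝ}
    (hQ : IsOptimalQ M γ Qs) {Rmax : ℝ} (hR : ∀ s a, ∀ᵐ x ∂(M.law s a), |x.2| ≤ Rmax)
    {s σ : S} (a : A) (hT : V.T s = V.T σ) : ∫ y, noiseTerm V γ Qs s σ a y ∂(M.law s a) = 0 := by
  have := M.isProb
  have hrow := measurable_of_finite (rowMax Qs)
  have hrint : ∀ ν : Measure (S × ℝ), IsProbabilityMeasure ν →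
      Integrable (fun x : S × ℝ => γ * rowMax Qs x.1) ν := by
    intro ν _
    obtain ⟨B, hB⟩ := (Set.finite_range fun s => ‖γ * rowMax Qs s‖).bddAbove
    exact Integrable.of_bound ((hrow.comp measurable_fst).const_mul γ).aestronglyMeasurable B
      (Filter.Eventually.of_forall fun x => hB ⟨x.1, rfl⟩)
  have hsnd : Integrable (fun x : S × ℝ => x.2) (M.law σ a) :=
    Integrable.of_bound measurable_snd.aestronglyMeasurable Rmax (hR σ a)
  have hid : Integrable (fun r : ℝ => r) ((M.law σ a).map Prod.snd) :=
    (integrable_map_measure measurable_id.aestronglyMeasurable measurable_snd.aemeasurable).2 hsnd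
  have hder : Integrable (fun x : S × ℝ => V.derive s σ a x.1 x.2) (M.law s a) := by
    rw [← V.reward_eq s σ a hT] at hid
    exact hid.comp_measurable (V.measurable_derive s σ a)
  have e1 : ∫ x, V.derive s σ a x.1 x.2 ∂(M.law s a) = ∫ x, x.2 ∂(M.law σ a) := by
    have e := congrArg (fun ν => ∫ r, r ∂ν) (V.reward_eq s σ a hT)
    beta_reduce at e
    rwa [integral_map (f := fun r => r) (V.measurable_derive s σ a).aemeasurable
      measurable_id.aestronglyMeasurable, integral_map (f := fun r => r)
      measurable_snd.aemeasurable measurable_id.aestronglyMeasurable] at e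
  have e2 : ∫ x, γ * rowMax Qs x.1 ∂(M.law s a) = ∫ x, γ * rowMax Qs x.1 ∂(M.law σ a) := by
    have e := congrArg (fun ν => ∫ s', γ * rowMax Qs s' ∂ν) (V.nextState_eq s σ a hT)
    beta_reduce at e
    rwa [integral_map measurable_fst.aemeasurable (hrow.const_mul γ).aestronglyMeasurable,
      integral_map measurable_fst.aemeasurable (hrow.const_mul γ).aestronglyMeasurable] at e
  change ∫ y, (V.derive s σ a y.1 y.2 + γ * rowMax Qs y.1) - Qs σ a ∂(M.law s a) = 0
  rw [integral_sub (f := fun y : S × ℝ => V.derive s σ a y.1 y.2 + γ * rowMax Qs y.1) (hder.add (hrint _ inferInstance)) (integrable_const _),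
    integral_add hder (hrint _ inferInstance), e1, e2, ← integral_add hsnd (hrint _ inferInstance),
    ← hQ σ a]
  simp

theorem ae_abs_noiseTerm_le (V : VirtualExperience M Z) {γ : ℝ} (hγ : 0 ≤ γ) (Qs : S → A → ℝ)
    {Rmax : ℝ} (hR : ∀ s a, ∀ᵐ x ∂(M.law s a), |x.2| ≤ Rmax)
    {s σ : S} (a : A) (hT : V.T s = V.T σ) :
    ∀ᵐ y ∂(M.law s a), |noiseTerm V γ Qs s σ a y| ≤ Rmax + (1 + γ) * ‖Qs‖ := by
  have h1 : ∀ᵐ r ∂((M.law σ a).map Prod.snd), |r| ≤ Rmax :=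
    (ae_map_iff measurable_snd.aemeasurable
      (measurableSet_le measurable_id.abs measurable_const)).2 (hR σ a)
  rw [← V.reward_eq s σ a hT] at h1
  filter_upwards [ae_of_ae_map (V.measurable_derive s σ a).aemeasurable h1] with y hy
  have h2 : |Qs σ a| ≤ ‖Qs‖ := (norm_le_pi_norm (Qs σ) a).trans (norm_le_pi_norm Qs σ)
  have h3 := mul_le_mul_of_nonneg_left (abs_rowMax_le Qs y.1) hγ
  rw [← abs_of_nonneg hγ, ← abs_mul, abs_of_nonneg hγ] at h3
  unfold noiseTerm
  rw [abs_le] at *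
  constructor <;> linarith

end NoiseTerm

section NoiseMeasurable

variable {S A Z Ω : Type*} [Fintype S] [MeasurableSpace S] [Fintype A] [MeasurableSpace A]
  [mΩ : MeasurableSpace Ω] {M : RewardMDP S A} {μ : Measure Ω} {ℱ : Filtration ℕ mΩ}
  {X : ℕ → Ω → S} {U : ℕ → Ω → A} {R : ℕ → Ω → ℝ}

theorem IsTrajectory.measurable_learningRate
    [MeasurableSingletonClass S] [MeasurableSingletonClass A]
    (h : IsTrajectory M μ ℱ X U R) (T : S → Z)
    (c : Clock) (φ : ℝ) (t : ℕ) (σ : S) (a : A) :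
    Measurable[ℱ t] fun ω =>
      learningRate T (fun t => X t ω) (fun t => U t ω) c φ t σ a := by
  classical
  have hcount : Measurable[ℱ t] fun ω =>
      clockValue T (fun t => X t ω) (fun t => U t ω) c t σ a := by
    cases c
    · exact measurable_const
    · simp only [clockValue, Finset.card_filter]
      refine (Finset.measurable_sum _ fun k hk => ?_).add_const 1
      refine Measurable.ite ?_ measurable_const measurable_const
      exact ℱ.mono (Finset.mem_range.1 hk) _
        (h.measurableSet_pair k fun s b => Updated T s b σ a)
  have hf : Measurable fun n : ℕ => 1 / (n : ℝ) ^ φ := measurable_of_countable _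
  exact hf.comp hcount

theorem IsTrajectory.measurable_cutRate
    [MeasurableSingletonClass S] [MeasurableSingletonClass A]
    (h : IsTrajectory M μ ℱ X U R) (T : S → Z)
    (c : Clock) (φ α₀ : ℝ) (t : ℕ) (σ : S) (a : A) :
    Measurable[ℱ t] fun ω =>
      cutRate T c φ α₀ (fun t => X t ω) (fun t => U t ω) t σ a := by
  have hl := h.measurable_learningRate T c φ t σ a
  exact Measurable.ite (hl measurableSet_Iic) hl measurable_const

theorem IsTrajectory.measurable_noiseAvg
    [MeasurableSingletonClass S] [MeasurableSingletonClass A] [Nonempty A]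
    (h : IsTrajectory M μ ℱ X U R)
    (V : VirtualExperience M Z) (c : Clock) (φ γ α₀ : ℝ) (Qs : S → A → ℝ) (t : ℕ) (σ : S) (a : A) :
    Measurable[ℱ t] fun ω => noiseAvg V c φ γ α₀ Qs (fun t => X t ω) (fun t => U t ω)
      (fun t => R t ω) t σ a := by
  induction t with
  | zero => exact measurable_const
  | succ t ih =>
    have ih' := ih.mono (ℱ.mono t.le_succ) le_rfl
    have hg := (h.measurable_cutRate V.T c φ α₀ t σ a).mono (ℱ.mono t.le_succ) le_rfl
    have hw : Measurable fun y : S × (S × ℝ) => noiseTerm V γ Qs y.1 σ a y.2 :=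
      measurable_from_prod_countable_right fun s => measurable_noiseTerm V γ Qs s σ a
    have hw' : Measurable[ℱ (t + 1)] fun ω => noiseTerm V γ Qs (X t ω) σ a (X (t + 1) ω, R t ω) :=
      hw.comp (((h.measurable_state t).mono (ℱ.mono t.le_succ) le_rfl).prodMk
        (h.measurable_outcome t))
    refine Measurable.ite (h.measurableSet_pair t fun s b => Updated V.T s b σ a) ?_ ih'
    exact ((measurable_const.sub hg).mul ih').add (hg.mul hw')

theorem IsTrajectory.lintegral_le_of_forall_pair
    [MeasurableSingletonClass S] [MeasurableSingletonClass A]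
    {f g : Ω → ℝ≥0∞}
    (h : IsTrajectory M μ ℱ X U R) (t : ℕ)
    (hfg : ∀ s a, ∫⁻ ω in {ω | X t ω = s ∧ U t ω = a}, f ω ∂μ
      ≤ ∫⁻ ω in {ω | X t ω = s ∧ U t ω = a}, g ω ∂μ) : ∫⁻ ω, f ω ∂μ ≤ ∫⁻ ω, g ω ∂μ := by
  have hm : ∀ p : S × A, MeasurableSet {ω | X t ω = p.1 ∧ U t ω = p.2} := fun p =>
    ℱ.le _ _ (h.measurableSet_pair t fun s' a' => s' = p.1 ∧ a' = p.2)
  have hd : Pairwise (Function.onFun Disjoint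
      fun p : S × A => {ω | X t ω = p.1 ∧ U t ω = p.2}) := by
    intro p p' hp
    refine Set.disjoint_left.2 fun ω h1 h2 => hp ?_
    exact Prod.ext (h1.1.symm.trans h2.1) (h1.2.symm.trans h2.2)
  have hu : ⋃ p : S × A, {ω | X t ω = p.1 ∧ U t ω = p.2} = Set.univ :=
    Set.eq_univ_of_forall fun ω => Set.mem_iUnion.2 ⟨(X t ω, U t ω), rfl, rfl⟩
  rw [← setLIntegral_univ f, ← setLIntegral_univ g, ← hu, lintegral_iUnion hm hd,
    lintegral_iUnion hm hd]
  exact ENNReal.tsum_le_tsum fun p => hfg p.1 p.2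

/-- In one iteration, the exponential moment of the averaged noise grows at most by a constant:
by Hoeffding's lemma it passes from `W` to at most `W ^ (1 - g) * exp v ^ g`, which is a weighted
geometric mean of `W` and `exp v`. -/
theorem IsTrajectory.lintegral_exp_noiseAvg_succ_le
    [MeasurableSingletonClass S] [MeasurableSingletonClass A] [Nonempty A]
    [IsProbabilityMeasure μ]
    (h : IsTrajectory M μ ℱ X U R)
    (V : VirtualExperience M Z) (c : Clock) {φ γ α₀ : ℝ} {Qs : S → A → ℝ} (hφ : 0 ≤ φ)
    (hα₀ : 0 ≤ α₀) (hγ : 0 ≤ γ) (hQ : IsOptimalQ M γ Qs) {Rmax : ℝ}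
    (hR : ∀ s a, ∀ᵐ x ∂(M.law s a), |x.2| ≤ Rmax) {K θ v : ℝ} (hK : 0 ≤ K)
    (hRK : Rmax + (1 + γ) * ‖Qs‖ ≤ K) (hv : θ ^ 2 * α₀ * K ^ 2 / 2 ≤ v) (t : ℕ) (σ : S) (a : A) :
    ∫⁻ ω, ENNReal.ofReal (Real.exp (θ * noiseAvg V c φ γ α₀ Qs (fun t => X t ω) (fun t => U t ω)
        (fun t => R t ω) (t + 1) σ a)) ∂μ
      ≤ ∫⁻ ω, (ENNReal.ofReal (Real.exp (θ * noiseAvg V c φ γ α₀ Qs (fun t => X t ω)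
        (fun t => U t ω) (fun t => R t ω) t σ a)) + ENNReal.ofReal (Real.exp v)) ∂μ := by
  refine h.lintegral_le_of_forall_pair t fun s b => ?_
  have := M.isProb s b
  have hBm : MeasurableSet {ω | X t ω = s ∧ U t ω = b} :=
    ℱ.le _ _ (h.measurableSet_pair t fun s' a' => s' = s ∧ a' = b)
  set z : Ω → ℝ := fun ω => noiseAvg V c φ γ α₀ Qs (fun t => X t ω) (fun t => U t ω)
        (fun t => R t ω) t σ a with hz
  set g : Ω → ℝ := fun ω => cutRate V.T c φ α₀ (fun t => X t ω) (fun t => U t ω) t σ a with hg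
  by_cases hup : Updated V.T s b σ a
  · obtain ⟨hT, rfl⟩ := hup
    have hY : Measurable[ℱ t] fun ω => (z ω, g ω) :=
      (h.measurable_noiseAvg V c φ γ α₀ Qs t σ a).prodMk (h.measurable_cutRate V.T c φ α₀ t σ a)
    have hw := measurable_noiseTerm V γ Qs s σ a
    have hf : Measurable fun p : (ℝ × ℝ) × (S × ℝ) => ENNReal.ofReal (Real.exp
        (θ * ((1 - p.1.2) * p.1.1 + p.1.2 * noiseTerm V γ Qs s σ a p.2))) := by
      have hw' : Measurable fun p : (ℝ × ℝ) × (S × ℝ) => noiseTerm V γ Qs s σ a p.2 :=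
        hw.comp measurable_snd
      fun_prop
    refine (le_of_eq ?_).trans ((h.lintegral_transition t s a hY hf).le.trans
      (lintegral_mono fun ω => ?_))
    · refine setLIntegral_congr_fun hBm fun ω hω => ?_
      obtain ⟨h1, h2⟩ := hω
      simp [noiseAvg, Updated, h1, h2, hT, hz, hg]
    · have g0 : 0 ≤ g ω := cutRate_nonneg _ _ _ _ _ _ _ _ _
      have g1 : g ω ≤ 1 := cutRate_le_one _ _ _ _ hφ _ _ _ _
      have g2 : g ω ≤ α₀ := cutRate_le _ _ _ _ _ hα₀ _ _ _
      have e : ∀ y, ENNReal.ofReal (Real.exp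
          (θ * ((1 - g ω) * z ω + g ω * noiseTerm V γ Qs s σ a y)))
          = ENNReal.ofReal (Real.exp ((1 - g ω) * (θ * z ω)))
            * ENNReal.ofReal (Real.exp (θ * g ω * noiseTerm V γ Qs s σ a y)) := by
        intro y
        rw [← ENNReal.ofReal_mul (Real.exp_pos _).le, ← Real.exp_add]
        congr 2
        ring
      simp only [e]
      rw [lintegral_const_mul _ (by fun_prop)]
      have hb : ∀ᵐ y ∂(M.law s a), |noiseTerm V γ Qs s σ a y| ≤ K :=
        (ae_abs_noiseTerm_le V hγ Qs hR a hT.symm).mono fun y hy => hy.trans hRK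
      refine (mul_le_mul_right (lintegral_exp_mul_le hw hK hb
        (integral_noiseTerm V hQ hR a hT.symm) _) _).trans ?_
      rw [← ENNReal.ofReal_mul (Real.exp_pos _).le, ← Real.exp_add,
        ← ENNReal.ofReal_add (Real.exp_pos _).le (Real.exp_pos _).le]
      refine ENNReal.ofReal_le_ofReal ?_
      have h3 : (θ * g ω) ^ 2 * K ^ 2 / 2 ≤ g ω * v := by
        have h4 : θ ^ 2 * g ω * K ^ 2 / 2 ≤ v := le_trans (by gcongr) hv
        nlinarith
      have h5 : (1 - g ω) * (θ * z ω) + g ω * v ≤ max (θ * z ω) v := by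
        nlinarith [le_max_left (θ * z ω) v, le_max_right (θ * z ω) v]
      refine (Real.exp_le_exp.2 ((add_le_add_right h3 _).trans h5)).trans ?_
      rcases max_choice (θ * z ω) v with h6 | h6 <;> rw [h6]
      · linarith [Real.exp_pos v]
      · linarith [Real.exp_pos (θ * z ω)]
  · refine setLIntegral_mono' hBm fun ω hω => ?_
    obtain ⟨h1, h2⟩ := hω
    have : ¬ Updated V.T (X t ω) (U t ω) σ a := by rwa [h1, h2]
    simp [noiseAvg, this]

/-- At each time, the averaged noise exceeds `η` only with exponentially small probability. -/
theorem IsTrajectory.measure_le_abs_noiseAvg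
    [MeasurableSingletonClass S] [MeasurableSingletonClass A] [Nonempty A]
    [IsProbabilityMeasure μ]
    (h : IsTrajectory M μ ℱ X U R)
    (V : VirtualExperience M Z) (c : Clock) {φ γ α₀ : ℝ} {Qs : S → A → ℝ} (hφ : 0 ≤ φ)
    (hα₀ : 0 < α₀) (hγ : 0 ≤ γ) (hQ : IsOptimalQ M γ Qs) {Rmax : ℝ}
    (hR : ∀ s a, ∀ᵐ x ∂(M.law s a), |x.2| ≤ Rmax) {K η : ℝ} (hK : 0 < K)
    (hη : 0 ≤ η) (hRK : Rmax + (1 + γ) * ‖Qs‖ ≤ K) (t : ℕ) (σ : S) (a : A) :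
    μ {ω | η ≤ |noiseAvg V c φ γ α₀ Qs (fun t => X t ω) (fun t => U t ω)
        (fun t => R t ω) t σ a|}
      ≤ ENNReal.ofReal (2 * (t + 1) * Real.exp (-(η ^ 2 / (2 * K ^ 2 * α₀)))) := by
  set z : ℕ → Ω → ℝ := fun t ω => noiseAvg V c φ γ α₀ Qs (fun t => X t ω) (fun t => U t ω)
        (fun t => R t ω) t σ a with hz
  set v := η ^ 2 / (2 * K ^ 2 * α₀) with hv
  have hv0 : 0 ≤ v := by positivity
  have hmom : ∀ θ : ℝ, θ ^ 2 * α₀ * K ^ 2 / 2 ≤ v → ∀ t : ℕ,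
      ∫⁻ ω, ENNReal.ofReal (Real.exp (θ * z t ω)) ∂μ
        ≤ ENNReal.ofReal ((t + 1) * Real.exp v) := by
    intro θ hθ t
    induction t with
    | zero =>
      simp only [hz, noiseAvg]
      simpa using hv0
    | succ t ih =>
      refine (h.lintegral_exp_noiseAvg_succ_le V c hφ hα₀.le hγ hQ hR hK.le hRK hθ t σ a).trans ?_
      rw [lintegral_add_right _ measurable_const, lintegral_const, measure_univ, mul_one]
      refine (add_le_add_left ih _).trans ?_
      rw [← ENNReal.ofReal_add (by positivity) (by positivity)]
      refine ENNReal.ofReal_le_ofReal (le_of_eq ?_)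
      push_cast
      ring
  have htail : ∀ θ : ℝ, θ ^ 2 * α₀ * K ^ 2 / 2 ≤ v →
      μ {ω | 2 * v ≤ θ * z t ω} ≤ ENNReal.ofReal ((t + 1) * Real.exp (-v)) := by
    intro θ hθ
    have hm : Measurable fun ω => ENNReal.ofReal (Real.exp (θ * z t ω)) := by
      have := (h.measurable_noiseAvg V c φ γ α₀ Qs t σ a).mono (ℱ.le t) le_rfl
      exact (Real.measurable_exp.comp (this.const_mul θ)).ennreal_ofReal
    have h1 := mul_meas_ge_le_lintegral (μ := μ) hm (ENNReal.ofReal (Real.exp (2 * v)))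
    have h2 : μ {ω | 2 * v ≤ θ * z t ω} ≤ μ {ω | ENNReal.ofReal (Real.exp (2 * v))
        ≤ ENNReal.ofReal (Real.exp (θ * z t ω))} :=
      measure_mono fun ω hω => ENNReal.ofReal_le_ofReal (Real.exp_le_exp.2 hω)
    have h3 := ((mul_le_mul_right h2 _).trans h1).trans (hmom θ hθ t)
    have e : (t + 1) * Real.exp v = Real.exp (2 * v) * ((t + 1) * Real.exp (-v)) := by
      have : Real.exp v = Real.exp (2 * v) * Real.exp (-v) := by rw [← Real.exp_add]; congr 1; ring
      rw [this]; ring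
    rw [e, ENNReal.ofReal_mul (Real.exp_pos _).le] at h3
    exact (ENNReal.mul_le_mul_iff_right (by simp [Real.exp_pos]) ENNReal.ofReal_ne_top).1 h3
  have hθ : (η / (K ^ 2 * α₀)) ^ 2 * α₀ * K ^ 2 / 2 ≤ v := by
    refine le_of_eq ?_
    rw [hv]; field_simp
  refine (measure_mono ?_).trans ((measure_union_le _ _).trans
    ((add_le_add (htail _ hθ) (htail (-(η / (K ^ 2 * α₀))) (by rwa [neg_sq]))).trans ?_))
  · have e : 2 * v = η / (K ^ 2 * α₀) * η := by
      rw [hv]; field_simp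
    intro ω hω
    rcases le_abs'.1 (show η ≤ |z t ω| from hω) with h1 | h1
    · right
      change 2 * v ≤ -(η / (K ^ 2 * α₀)) * z t ω
      rw [e, neg_mul, ← mul_neg]
      exact mul_le_mul_of_nonneg_left (by linarith) (by positivity)
    · left
      change 2 * v ≤ η / (K ^ 2 * α₀) * z t ω
      rw [e]
      exact mul_le_mul_of_nonneg_left h1 (by positivity)
  · rw [← ENNReal.ofReal_add (by positivity) (by positivity)]
    refine ENNReal.ofReal_le_ofReal (le_of_eq ?_)
    ring

end NoiseMeasurable

/-! ### Covered blocks of iterations -/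

section Cover

open Classical in
/-- The number of those among the first `n` consecutive blocks of `L` iterations from time `t₀` on
in which all pairs are updated. -/
noncomputable def coverCount {S A Z : Type*} (T : S → Z) (x : ℕ → S) (u : ℕ → A)
    (t₀ L n : ℕ) : ℕ :=
  ((Finset.range n).filter fun i => ∀ σ a, ∃ k, t₀ + i * L ≤ k ∧ k < t₀ + i * L + L ∧
    Updated T (x k) (u k) σ a).card

open Classical in
theorem coverCount_le_card {S A Z : Type*} (T : S → Z) (x : ℕ → S) (u : ℕ → A)
    (t₀ L n : ℕ) (σ : S) (a : A) : coverCount T x u t₀ L n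
      ≤ ((Finset.Ico t₀ (t₀ + n * L)).filter fun k => Updated T (x k) (u k) σ a).card := by
  simp only [coverCount, Finset.card_filter]
  induction n with
  | zero => simp
  | succ n ih =>
    rw [Finset.sum_range_succ, ← Finset.sum_Ico_consecutive _ (Nat.le_add_right t₀ (n * L))
      (by gcongr; omega : t₀ + n * L ≤ t₀ + (n + 1) * L)]
    refine add_le_add ih ?_
    split_ifs with h
    · obtain ⟨k, h1, h2, h3⟩ := h σ a
      have hk : k ∈ Finset.Ico (t₀ + n * L) (t₀ + (n + 1) * L) :=
        Finset.mem_Ico.2 ⟨h1, by linarith [add_mul n 1 L]⟩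
      refine le_trans ?_ (Finset.single_le_sum (fun i _ => Nat.zero_le _) hk)
      simp [h3]
    · exact Nat.zero_le _

variable {S A Z Ω : Type*} [Fintype S] [MeasurableSpace S] [MeasurableSingletonClass S]
  [Fintype A] [MeasurableSpace A] [MeasurableSingletonClass A]
  [mΩ : MeasurableSpace Ω] {M : RewardMDP S A} {μ : Measure Ω} {ℱ : Filtration ℕ mΩ}
  {X : ℕ → Ω → S} {U : ℕ → Ω → A} {R : ℕ → Ω → ℝ}

theorem IsTrajectory.measurableSet_coverEvent (h : IsTrajectory M μ ℱ X U R) (T : S → Z)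
    (t L : ℕ) : MeasurableSet[ℱ (t + L)] (coverEvent T X U t L) := by
  have e : coverEvent T X U t L
      = ⋂ σ, ⋂ a, ⋃ k ∈ Finset.Ico t (t + L), {ω | Updated T (X k ω) (U k ω) σ a} := by
    ext ω
    simp [coverEvent, and_assoc]
  rw [e]
  refine MeasurableSet.iInter fun σ => MeasurableSet.iInter fun a =>
    Finset.measurableSet_biUnion _ fun k hk => ?_
  exact ℱ.mono (Finset.mem_Ico.1 hk).2 _ (h.measurableSet_pair k fun s b => Updated T s b σ a)

theorem IsTrajectory.measurable_coverCount (h : IsTrajectory M μ ℱ X U R) (T : S → Z)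
    (t₀ L n : ℕ) : Measurable[ℱ (t₀ + n * L)] fun ω =>
      coverCount T (fun t => X t ω) (fun t => U t ω) t₀ L n := by
  simp only [coverCount, Finset.card_filter]
  refine Finset.measurable_sum _ fun i hi => ?_
  refine Measurable.ite ?_ measurable_const measurable_const
  have hi' : t₀ + i * L + L ≤ t₀ + n * L := by
    have : (i + 1) * L ≤ n * L := Nat.mul_le_mul_right L (Finset.mem_range.1 hi)
    linarith [add_mul i 1 L]
  exact ℱ.mono hi' _ (h.measurableSet_coverEvent T (t₀ + i * L) L)

/-- The covering condition for nonnegative weights depending on the past, in place of events. -/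
theorem CoversWithProb.mul_lintegral_le [IsFiniteMeasure μ] {T : S → Z} {L : ℕ} {p : ℝ}
    (hcov : CoversWithProb T μ ℱ X U L p) (h : IsTrajectory M μ ℱ X U R) (t : ℕ)
    {β : Type*} [MeasurableSpace β] {Y : Ω → β} (hY : Measurable[ℱ t] Y) {f : β → ℝ≥0∞}
    (hf : Measurable f) :
    ENNReal.ofReal p * ∫⁻ ω, f (Y ω) ∂μ ≤ ∫⁻ ω in coverEvent T X U t L, f (Y ω) ∂μ := by
  have hY' : Measurable Y := hY.mono (ℱ.le t) le_rfl
  have hC := ℱ.le _ _ (h.measurableSet_coverEvent T t L)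
  have key : ENNReal.ofReal p • μ.map Y ≤ (μ.restrict (coverEvent T X U t L)).map Y := by
    refine Measure.le_iff.2 fun E hE => ?_
    rw [Measure.smul_apply, smul_eq_mul, Measure.map_apply hY' hE, Measure.map_apply hY' hE,
      Measure.restrict_apply (hY' hE)]
    exact hcov t _ (hY hE)
  rw [← lintegral_map hf hY', ← lintegral_map hf hY', ← smul_eq_mul, ← lintegral_smul_measure]
  exact lintegral_mono' key le_rfl

theorem CoversWithProb.lintegral_coverCount_le [IsProbabilityMeasure μ] {T : S → Z} {L : ℕ} {p : ℝ}
    (hcov : CoversWithProb T μ ℱ X U L p) (h : IsTrajectory M μ ℱ X U R) (hp : 0 ≤ p)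
    (hp1 : p ≤ 1) (t₀ n : ℕ) :
    ∫⁻ ω, ENNReal.ofReal ((1 / 2) ^ coverCount T (fun t => X t ω) (fun t => U t ω) t₀ L n) ∂μ
      ≤ ENNReal.ofReal ((1 - p / 2) ^ n) := by
  classical
  set N : ℕ → Ω → ℕ := fun n ω => coverCount T (fun t => X t ω) (fun t => U t ω) t₀ L n with hN
  set f : ℕ → ℝ≥0∞ := fun k => ENNReal.ofReal ((1 / 2) ^ k) with hf
  induction n with
  | zero => simp [coverCount]
  | succ n ih =>
    set B := coverEvent T X U (t₀ + n * L) L with hB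
    have hBm : MeasurableSet B := ℱ.le _ _ (h.measurableSet_coverEvent T _ L)
    have h1 := hcov.mul_lintegral_le h (t₀ + n * L) (h.measurable_coverCount T t₀ L n)
      (measurable_of_countable f)
    have hle : ∀ ω, f (N n ω) ≤ 1 := fun ω => by
      rw [hf, ← ENNReal.ofReal_one]
      exact ENNReal.ofReal_le_ofReal (pow_le_one₀ (by norm_num) (by norm_num))
    have hfin : ∫⁻ ω, f (N n ω) ∂μ ≠ ∞ :=
      ((lintegral_mono hle).trans_lt (by simp)).ne
    have hsplit := lintegral_add_compl (fun ω => f (N n ω)) hBm (μ := μ)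
    have hsplit' := lintegral_add_compl (fun ω => f (N (n + 1) ω)) hBm (μ := μ)
    have e1 : ∫⁻ ω in B, f (N (n + 1) ω) ∂μ = ENNReal.ofReal (1 / 2) * ∫⁻ ω in B, f (N n ω) ∂μ := by
      rw [← lintegral_const_mul' _ _ ENNReal.ofReal_ne_top]
      refine setLIntegral_congr_fun hBm fun ω hω => ?_
      have : N (n + 1) ω = N n ω + 1 := by
        simp only [hN, coverCount, Finset.card_filter, Finset.sum_range_succ]
        exact congrArg _ (if_pos hω)
      simp only [this, hf, pow_succ']
      rw [ENNReal.ofReal_mul (by norm_num)]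
    have e2 : ∫⁻ ω in Bᶜ, f (N (n + 1) ω) ∂μ = ∫⁻ ω in Bᶜ, f (N n ω) ∂μ := by
      refine setLIntegral_congr_fun hBm.compl fun ω hω => ?_
      have : N (n + 1) ω = N n ω := by
        simp only [hN, coverCount, Finset.card_filter, Finset.sum_range_succ]
        exact (congrArg _ (if_neg hω)).trans (add_zero _)
      simp only [this]
    change ∫⁻ ω, f (N (n + 1) ω) ∂μ ≤ _
    rw [← hsplit', e1, e2]
    change ENNReal.ofReal p * ∫⁻ ω, f (N n ω) ∂μ ≤ ∫⁻ ω in B, f (N n ω) ∂μ at h1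
    change ∫⁻ ω, f (N n ω) ∂μ ≤ _ at ih
    rw [← hsplit] at hfin h1 ih
    obtain ⟨ha, hb⟩ := ENNReal.add_ne_top.1 hfin
    lift (∫⁻ ω in B, f (N n ω) ∂μ) to NNReal using ha with a
    lift (∫⁻ ω in Bᶜ, f (N n ω) ∂μ) to NNReal using hb with b
    rw [← ENNReal.ofReal_coe_nnreal, ← ENNReal.ofReal_coe_nnreal,
      ← ENNReal.ofReal_add a.coe_nonneg b.coe_nonneg] at h1 ih
    rw [← ENNReal.ofReal_mul hp, ENNReal.ofReal_le_ofReal_iff a.coe_nonneg] at h1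
    have hp2 : 0 ≤ 1 - p / 2 := by linarith
    rw [ENNReal.ofReal_le_ofReal_iff (pow_nonneg hp2 n)] at ih
    rw [← ENNReal.ofReal_coe_nnreal, ← ENNReal.ofReal_coe_nnreal, ← ENNReal.ofReal_mul (by norm_num),
      ← ENNReal.ofReal_add (by positivity) b.coe_nonneg]
    refine ENNReal.ofReal_le_ofReal ?_
    have := mul_le_mul_of_nonneg_left ih hp2
    rw [pow_succ']
    linarith

/-- Up to a constant factor, the proportion of covered blocks is at least `p`, except with
exponentially small probability. -/
theorem CoversWithProb.measure_coverCount_lt [IsProbabilityMeasure μ] {T : S → Z} {L : ℕ} {p : ℝ}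
    (hcov : CoversWithProb T μ ℱ X U L p) (h : IsTrajectory M μ ℱ X U R) (hp : 0 ≤ p)
    (hp1 : p ≤ 1) (t₀ n : ℕ) :
    μ {ω | (coverCount T (fun t => X t ω) (fun t => U t ω) t₀ L n : ℝ) < n * p / 4}
      ≤ ENNReal.ofReal (Real.exp (-(n * p / 4))) := by
  have hm : Measurable fun ω =>
      ENNReal.ofReal ((1 / 2) ^ coverCount T (fun t => X t ω) (fun t => U t ω) t₀ L n) :=
    (measurable_of_countable fun k : ℕ => ENNReal.ofReal ((1 / 2) ^ k)).comp
      ((h.measurable_coverCount T t₀ L n).mono (ℱ.le _) le_rfl)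
  have h1 := mul_meas_ge_le_lintegral (μ := μ) hm (ENNReal.ofReal (Real.exp (-(n * p / 4))))
  have h2 : μ {ω | (coverCount T (fun t => X t ω) (fun t => U t ω) t₀ L n : ℝ) < n * p / 4}
      ≤ μ {ω | ENNReal.ofReal (Real.exp (-(n * p / 4))) ≤ ENNReal.ofReal ((1 / 2) ^
        coverCount T (fun t => X t ω) (fun t => U t ω) t₀ L n)} := by
    refine measure_mono fun ω hω => ENNReal.ofReal_le_ofReal ?_
    have h3 : Real.exp (-1) ≤ 1 / 2 := by
      rw [Real.exp_neg, ← one_div]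
      exact one_div_le_one_div_of_le (by norm_num) (by linarith [Real.add_one_le_exp (1 : ℝ)])
    refine (Real.exp_le_exp.2 (neg_le_neg (le_of_lt hω))).trans ?_
    refine le_trans (le_of_eq ?_) (pow_le_pow_left₀ (Real.exp_pos _).le h3 _)
    rw [← Real.exp_nat_mul]
    congr 1
    ring
  have h4 : (1 - p / 2) ^ n ≤ Real.exp (-(n * p / 4)) * Real.exp (-(n * p / 4)) := by
    rw [← Real.exp_add]
    refine (pow_le_pow_left₀ (by linarith) (Real.one_sub_le_exp_neg (p / 2)) n).trans
      (le_of_eq ?_)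
    rw [← Real.exp_nat_mul]
    congr 1
    ring
  have h5 := ((mul_le_mul_right h2 _).trans h1).trans
    ((hcov.lintegral_coverCount_le h hp hp1 t₀ n).trans (ENNReal.ofReal_le_ofReal h4))
  rw [ENNReal.ofReal_mul (Real.exp_pos _).le] at h5
  exact (ENNReal.mul_le_mul_iff_right (by simp [Real.exp_pos]) ENNReal.ofReal_ne_top).1 h5

end Cover

/-! ### Contraction along a path -/

/-- Averaging towards an interval of radius `κ` with total weight at least `Λ` leaves at most the
fraction `exp (-Λ)` of the initial deviation. -/
theorem abs_le_of_averaging {ι : Type*} {y b : ℕ → ι → ℝ} {T T' τ : ℕ} {D κ Λ : ℝ}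
    (hD : 0 ≤ D) (hκ : 0 ≤ κ) (hy : ∀ i, |y T i| ≤ D) (hb0 : ∀ t i, 0 ≤ b t i)
    (hb1 : ∀ t i, b t i ≤ 1)
    (hstep : ∀ t, T ≤ t → t < τ → ∀ i, |y (t + 1) i| ≤ (1 - b t i) * |y t i| + b t i * κ)
    (hΛ : ∀ i, Λ ≤ ∑ k ∈ Finset.Ico T T', b k i) {t : ℕ} (hTt : T ≤ t) (ht : T' ≤ t)
    (htτ : t ≤ τ) (i : ι) : |y t i| ≤ κ + Real.exp (-Λ) * D := by
  have key : ∀ s, T ≤ s → s ≤ τ →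
      |y s i| ≤ κ + Real.exp (-∑ k ∈ Finset.Ico T s, b k i) * D := by
    intro s hs
    induction s, hs using Nat.le_induction with
    | base => intro _; simp; linarith [hy i]
    | succ s hs ih =>
      intro hsτ
      have h1 := mul_le_mul_of_nonneg_left (ih (by omega)) (sub_nonneg.2 (hb1 s i))
      have h2 := hstep s hs (by omega) i
      rw [Finset.sum_Ico_succ_top hs, neg_add, Real.exp_add]
      have h3 := mul_le_mul_of_nonneg_left (Real.one_sub_le_exp_neg (b s i))
        (mul_nonneg (Real.exp_pos (-∑ k ∈ Finset.Ico T s, b k i)).le hD)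
      linarith
  have hmono : ∑ k ∈ Finset.Ico T T', b k i ≤ ∑ k ∈ Finset.Ico T t, b k i :=
    Finset.sum_le_sum_of_subset_of_nonneg (Finset.Ico_subset_Ico_right ht)
      fun k _ _ => hb0 k i
  refine (key t hTt htτ).trans ?_
  have := (hΛ i).trans hmono
  gcongr

/-- A bound that is contracted by the factor `ρ`, up to the perturbation `η`, in each of the
consecutive phases of length `m` from time `T` on. -/
theorem abs_le_of_phases {ι : Type*} {y b : ℕ → ι → ℝ} {T m τ : ℕ} {D γ η Λ ρ : ℝ}
    (hD : 0 ≤ D) (hγ : 0 ≤ γ) (hγ1 : γ ≤ 1) (hη : 0 ≤ η)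
    (hy : ∀ t, T ≤ t → t ≤ τ → ∀ i, |y t i| ≤ D)
    (hb0 : ∀ t i, 0 ≤ b t i) (hb1 : ∀ t i, b t i ≤ 1)
    (hstep : ∀ t, T ≤ t → t < τ → ∀ B, (∀ i, |y t i| ≤ B) → ∀ i,
      |y (t + 1) i| ≤ (1 - b t i) * |y t i| + b t i * (γ * (B + η)))
    (hρ : γ + Real.exp (-Λ) ≤ ρ) (hρ1 : ρ < 1) (J : ℕ)
    (hΛ : ∀ j < J, ∀ i, Λ ≤ ∑ k ∈ Finset.Ico (T + j * m) (T + (j + 1) * m), b k i)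
    {t : ℕ} (ht : T + J * m ≤ t) (htτ : t ≤ τ) (i : ι) :
    |y t i| ≤ ρ ^ J * D + η / (1 - ρ) := by
  have hρ0 : 0 ≤ ρ := (add_nonneg hγ (Real.exp_pos _).le).trans hρ
  have hq : 0 ≤ η / (1 - ρ) := div_nonneg hη (by linarith)
  induction J generalizing t i with
  | zero => simpa using (hy t (by omega) htτ i).trans (le_add_of_nonneg_right hq)
  | succ J ih =>
    have hle : T + J * m ≤ T + (J + 1) * m := by gcongr; omega
    have ih' : ∀ s, T + J * m ≤ s → s ≤ τ → ∀ i, |y s i| ≤ ρ ^ J * D + η / (1 - ρ) :=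
      fun s hs hsτ i => ih (fun j hj => hΛ j (by omega)) hs hsτ i
    have h0 : 0 ≤ ρ ^ J * D + η / (1 - ρ) := by positivity
    have h1 := abs_le_of_averaging (τ := τ) (T := T + J * m) (T' := T + (J + 1) * m) h0
      (κ := γ * (ρ ^ J * D + η / (1 - ρ) + η)) (by positivity)
      (ih' _ le_rfl (by omega)) hb0 hb1
      (fun s hs hsτ i => hstep s (by omega) hsτ _ (ih' s hs hsτ.le) i)
      (hΛ J (by omega)) (by omega) ht htτ i
    have e : η / (1 - ρ) = ρ * (η / (1 - ρ)) + η := by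
      have : 1 - ρ ≠ 0 := by linarith
      field_simp
      ring
    have h2 := mul_le_mul_of_nonneg_right hρ h0
    have h3 : γ * η ≤ η := mul_le_of_le_one_left hη hγ1
    rw [pow_succ']
    linarith

section Path

variable {S A Z : Type*} [MeasurableSpace S] [Fintype A] [Nonempty A]
  {M : RewardMDP S A}

theorem qTable_succ_sub (V : VirtualExperience M Z) (c : Clock) (φ γ : ℝ) (Q₀ Qs : S → A → ℝ)
    (x : ℕ → S) (u : ℕ → A) (r : ℕ → ℝ) (t : ℕ) {σ : S} {a : A}
    (h : Updated V.T (x t) (u t) σ a) :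
    qTable V c φ γ Q₀ x u r (t + 1) σ a - Qs σ a
      = (1 - learningRate V.T x u c φ t σ a) * (qTable V c φ γ Q₀ x u r t σ a - Qs σ a)
        + learningRate V.T x u c φ t σ a *
          (γ * (rowMax (qTable V c φ γ Q₀ x u r t) (x (t + 1)) - rowMax Qs (x (t + 1)))
            + noiseTerm V γ Qs (x t) σ a (x (t + 1), r t)) := by
  simp only [qTable, if_pos h, noiseTerm]
  ring

theorem abs_qTable_sub_le [Fintype S] (V : VirtualExperience M Z) (c : Clock) {φ γ : ℝ} (hφ : 0 ≤ φ)
    (hγ : 0 ≤ γ) {Q₀ Qs : S → A → ℝ} {x : ℕ → S} {u : ℕ → A} {r : ℕ → ℝ} {K D : ℝ} (hD : 0 ≤ D)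
    (hw : ∀ t σ, V.T (x t) = V.T σ → |noiseTerm V γ Qs (x t) σ (u t) (x (t + 1), r t)| ≤ K)
    (hKD : K ≤ (1 - γ) * D) (h0 : ∀ σ a, |Q₀ σ a - Qs σ a| ≤ D) (t : ℕ) (σ : S) (a : A) :
    |qTable V c φ γ Q₀ x u r t σ a - Qs σ a| ≤ D := by
  induction t generalizing σ a with
  | zero => exact h0 σ a
  | succ t ih =>
    by_cases hup : Updated V.T (x t) (u t) σ a
    · have hw' := hw t σ hup.1.symm
      rw [← hup.2] at hw'
      have hm : |rowMax (qTable V c φ γ Q₀ x u r t) (x (t + 1)) - rowMax Qs (x (t + 1))| ≤ D :=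
        (abs_rowMax_sub_le _ _ _).trans ((pi_norm_le_iff_of_nonneg hD).2 fun σ =>
          (pi_norm_le_iff_of_nonneg hD).2 fun a => ih σ a)
      have hα := (learningRate_pos V.T x u c φ t σ a).le
      have hα1 := learningRate_le_one V.T x u c hφ t σ a
      rw [qTable_succ_sub V c φ γ Q₀ Qs x u r t hup]
      refine (abs_add_le _ _).trans ?_
      rw [abs_mul, abs_mul, abs_of_nonneg hα, abs_of_nonneg (sub_nonneg.2 hα1)]
      have h1 := mul_le_mul_of_nonneg_left (ih σ a) (sub_nonneg.2 hα1)
      have h2 : |γ * (rowMax (qTable V c φ γ Q₀ x u r t) (x (t + 1)) - rowMax Qs (x (t + 1)))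
            + noiseTerm V γ Qs (x t) σ a (x (t + 1), r t)| ≤ D := by
        refine (abs_add_le _ _).trans ?_
        rw [abs_mul, abs_of_nonneg hγ]
        linarith [mul_le_mul_of_nonneg_left hm hγ]
      linarith [mul_le_mul_of_nonneg_left h2 hα]
    · simp only [qTable, if_neg hup]
      exact ih σ a

open Classical in
/-- If along the path the averaged noise is small and all pairs are updated often enough, then the
table is close to the fixed point: the difference between the error and the averaged noise is
contracted in each phase. The first phase only serves to make the learning rates small. -/
theorem norm_qTable_sub_le_of_path [Fintype S] (V : VirtualExperience M Z) (c : Clock) {φ γ : ℝ} (hφ : 0 ≤ φ)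
    (hγ : 0 ≤ γ) (hγ1 : γ < 1) {Q₀ Qs : S → A → ℝ} {x : ℕ → S} {u : ℕ → A} {r : ℕ → ℝ}
    {K D η N ρ : ℝ} (hD : 0 ≤ D) (hη : 0 ≤ η) (hN : 0 < N)
    (hw : ∀ t σ, V.T (x t) = V.T σ → |noiseTerm V γ Qs (x t) σ (u t) (x (t + 1), r t)| ≤ K)
    (hKD : K ≤ (1 - γ) * D) (h0 : ∀ σ a, |Q₀ σ a - Qs σ a| ≤ D) {J m τ : ℕ}
    (hm : (J + 1) * m ≤ τ)
    (hZ : ∀ t ≤ τ, ∀ σ a, |noiseAvg V c φ γ (1 / N ^ φ) Qs x u r t σ a| ≤ η)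
    (hcount : ∀ j ≤ J, ∀ σ a, N ≤ ((Finset.Ico (j * m) ((j + 1) * m)).filter
      fun k => Updated V.T (x k) (u k) σ a).card)
    (hρ : γ + Real.exp (-(N * (1 / (τ : ℝ) ^ φ))) ≤ ρ) (hρ1 : ρ < 1) :
    ‖qTable V c φ γ Q₀ x u r τ - Qs‖ ≤ ρ ^ J * (D + η) + η / (1 - ρ) + η := by
  set Q := qTable V c φ γ Q₀ x u r with hQ
  set ζ := noiseAvg V c φ γ (1 / N ^ φ) Qs x u r with hζ
  set y : ℕ → S × A → ℝ := fun t p => Q t p.1 p.2 - Qs p.1 p.2 - ζ t p.1 p.2 with hy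
  set b : ℕ → S × A → ℝ := fun t p =>
    if Updated V.T (x t) (u t) p.1 p.2 then learningRate V.T x u c φ t p.1 p.2 else 0 with hb
  have hQD := abs_qTable_sub_le V c hφ hγ hD hw hKD h0
  have hyD : ∀ t, m ≤ t → t ≤ τ → ∀ p, |y t p| ≤ D + η := fun t _ ht p =>
    (abs_sub _ _).trans (add_le_add (hQD t p.1 p.2) (hZ t ht p.1 p.2))
  have hb0 : ∀ t p, 0 ≤ b t p := by
    intro t p
    simp only [hb]
    split_ifs
    exacts [(learningRate_pos _ _ _ _ _ _ _ _).le, le_rfl]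
  have hb1 : ∀ t p, b t p ≤ 1 := by
    intro t p
    simp only [hb]
    split_ifs
    exacts [learningRate_le_one _ _ _ _ hφ _ _ _, zero_le_one]
  have hsum : ∀ j ≤ J, ∀ p, N * (1 / (τ : ℝ) ^ φ)
      ≤ ∑ k ∈ Finset.Ico (j * m) ((j + 1) * m), b k p := by
    intro j hj p
    simp only [hb]
    rw [← Finset.sum_filter]
    have h1 : ∀ k ∈ (Finset.Ico (j * m) ((j + 1) * m)).filter
        (fun k => Updated V.T (x k) (u k) p.1 p.2),
        1 / (τ : ℝ) ^ φ ≤ learningRate V.T x u c φ k p.1 p.2 := by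
      intro k hk
      have hk' := (Finset.mem_Ico.1 (Finset.mem_filter.1 hk).1).2
      have : (j + 1) * m ≤ (J + 1) * m := by gcongr
      exact le_learningRate V.T x u c hφ (by omega) p.1 p.2
    have h2 := Finset.card_nsmul_le_sum _ _ _ h1
    rw [nsmul_eq_mul] at h2
    exact (mul_le_mul_of_nonneg_right (hcount j hj p.1 p.2) (by positivity)).trans h2
  have hstep : ∀ t, m ≤ t → t < τ → ∀ B, (∀ p, |y t p| ≤ B) → ∀ p,
      |y (t + 1) p| ≤ (1 - b t p) * |y t p| + b t p * (γ * (B + η)) := by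
    intro t hmt htτ B hB p
    by_cases hup : Updated V.T (x t) (u t) p.1 p.2
    · have hbt : b t p = learningRate V.T x u c φ t p.1 p.2 := if_pos hup
      -- after the first phase the learning rate has passed below the threshold of `cutRate`
      have hcut : cutRate V.T c φ (1 / N ^ φ) x u t p.1 p.2
          = learningRate V.T x u c φ t p.1 p.2 := by
        refine if_pos (learningRate_le V.T x u c hφ p.1 p.2 hN ?_)
        refine (hcount 0 (Nat.zero_le J) p.1 p.2).trans ?_
        refine Nat.cast_le.2 (Finset.card_le_card (Finset.filter_subset_filter _ fun k hk => ?_))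
        simp only [Finset.mem_Ico, zero_mul, zero_add, one_mul, Finset.mem_range] at hk ⊢
        omega
      have hζs : ζ (t + 1) p.1 p.2 = (1 - b t p) * ζ t p.1 p.2
          + b t p * noiseTerm V γ Qs (x t) p.1 p.2 (x (t + 1), r t) := by
        simp only [hζ, noiseAvg, if_pos hup, hcut, hbt]
      have hys : y (t + 1) p = (1 - b t p) * y t p
          + b t p * (γ * (rowMax (Q t) (x (t + 1)) - rowMax Qs (x (t + 1)))) := by
        have := qTable_succ_sub V c φ γ Q₀ Qs x u r t hup
        simp only [hy]
        rw [hζs, hQ, this, ← hbt]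
        ring
      have hB0 : 0 ≤ B := (abs_nonneg _).trans (hB p)
      have hmax : |rowMax (Q t) (x (t + 1)) - rowMax Qs (x (t + 1))| ≤ B + η := by
        refine (abs_rowMax_sub_le _ _ _).trans
          ((pi_norm_le_iff_of_nonneg (by positivity)).2 fun σ =>
            (pi_norm_le_iff_of_nonneg (by positivity)).2 fun a => ?_)
        have e : (Q t - Qs) σ a = y t (σ, a) + ζ t σ a := by simp [hy]
        rw [e]
        exact (abs_add_le _ _).trans (add_le_add (hB (σ, a)) (hZ t htτ.le σ a))
      rw [hys]
      refine (abs_add_le _ _).trans ?_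
      rw [abs_mul, abs_mul, abs_mul, abs_of_nonneg (hb0 t p), abs_of_nonneg hγ,
        abs_of_nonneg (sub_nonneg.2 (hb1 t p))]
      have := hb0 t p
      gcongr
    · have hbt : b t p = 0 := if_neg hup
      simp [hy, hQ, hζ, qTable, noiseAvg, if_neg hup, hbt]
  have hfin := abs_le_of_phases (J := J) (m := m) (by positivity : 0 ≤ D + η) hγ hγ1.le hη
    hyD hb0 hb1 hstep hρ hρ1
    (fun j hj p => by
      have := hsum (j + 1) hj p
      rwa [show (j + 1) * m = m + j * m by ring, show (j + 1 + 1) * m = m + (j + 1) * m by ring]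
        at this)
    (t := τ) (by linarith [add_mul J 1 m]) le_rfl
  have hρ0 : 0 ≤ ρ := (add_nonneg hγ (Real.exp_pos _).le).trans hρ
  have hq : 0 ≤ η / (1 - ρ) := div_nonneg hη (by linarith)
  refine (pi_norm_le_iff_of_nonneg (by positivity)).2 fun σ =>
    (pi_norm_le_iff_of_nonneg (by positivity)).2 fun a => ?_
  have e : (Q τ - Qs) σ a = y τ (σ, a) + ζ τ σ a := by simp [hy]
  rw [e]
  exact (abs_add_le _ _).trans (add_le_add (hfin (σ, a)) (hZ τ le_rfl σ a))

end Path

/-! ### The error probability at a fixed time -/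

/-- The table is inaccurate at time `τ` only if in some phase too few blocks of iterations are
covered, or if the averaged noise is large at some time; the union bound costs only factors
polynomial in `τ`. -/
theorem IsTrajectory.measure_compl_norm_le {S A Z Ω : Type*} [Fintype S] [MeasurableSpace S]
    [MeasurableSingletonClass S] [Fintype A] [Nonempty A] [MeasurableSpace A]
    [MeasurableSingletonClass A] [mΩ : MeasurableSpace Ω] {M : RewardMDP S A} {μ : Measure Ω}
    [IsProbabilityMeasure μ] {ℱ : Filtration ℕ mΩ}
    {X : ℕ → Ω → S} {U : ℕ → Ω → A} {R : ℕ → Ω → ℝ} (h : IsTrajectory M μ ℱ X U R)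
    (V : VirtualExperience M Z) (c : Clock) {φ γ : ℝ} (hφ : 0 ≤ φ) (hγ : 0 ≤ γ) (hγ1 : γ < 1)
    {Q₀ Qs : S → A → ℝ} (hQ : IsOptimalQ M γ Qs) {Rmax : ℝ}
    (hR : ∀ s a, ∀ᵐ x ∂(M.law s a), |x.2| ≤ Rmax) {K D η ρ p : ℝ} (hK : 0 < K) (hD : 0 ≤ D)
    (hη : 0 ≤ η) (hRK : Rmax + (1 + γ) * ‖Qs‖ ≤ K) (hKD : K ≤ (1 - γ) * D)
    (h0 : ∀ σ a, |Q₀ σ a - Qs σ a| ≤ D) {J m n L τ : ℕ} (hm : (J + 1) * m ≤ τ) (hn : n * L ≤ m)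
    (hp : 0 ≤ p) (hp1 : p ≤ 1) (hcov : CoversWithProb V.T μ ℱ X U L p) (hN : 0 < n * p / 4)
    (hρ : γ + Real.exp (-(n * p / 4 * (1 / (τ : ℝ) ^ φ))) ≤ ρ) (hρ1 : ρ < 1) :
    μ {ω | ‖qTable V c φ γ Q₀ (fun t => X t ω) (fun t => U t ω) (fun t => R t ω) τ - Qs‖
        ≤ ρ ^ J * (D + η) + η / (1 - ρ) + η}ᶜ
      ≤ ENNReal.ofReal ((J + 1) * Real.exp (-(n * p / 4))
        + (τ + 1) * (Fintype.card S * (Fintype.card A * (2 * (τ + 1)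
          * Real.exp (-(η ^ 2 / (2 * K ^ 2) * (n * p / 4) ^ φ)))))) := by
  classical
  set N := n * p / 4 with hNdef
  set w : Set Ω := {ω | ∀ t σ, V.T (X t ω) = V.T σ →
    |noiseTerm V γ Qs (X t ω) σ (U t ω) (X (t + 1) ω, R t ω)| ≤ K} with hw
  set E : ℕ → Set Ω := fun j =>
    {ω | (coverCount V.T (fun t => X t ω) (fun t => U t ω) (j * m) L n : ℝ) < N} with hE
  set F : ℕ → S → A → Set Ω := fun t σ a =>
    {ω | η ≤ |noiseAvg V c φ γ (1 / N ^ φ) Qs (fun t => X t ω) (fun t => U t ω)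
      (fun t => R t ω) t σ a|} with hF
  have hwae : μ wᶜ = 0 := by
    have := h.ae_outcome
      (p := fun s a y => ∀ σ, V.T s = V.T σ → |noiseTerm V γ Qs s σ a y| ≤ K)
      (fun s a => ?_) (fun s a => ?_)
    · exact this
    · have e : {y | ∀ σ, V.T s = V.T σ → |noiseTerm V γ Qs s σ a y| ≤ K}
          = ⋂ σ, {y | V.T s = V.T σ → |noiseTerm V γ Qs s σ a y| ≤ K} := by
        ext; simp
      rw [e]
      refine MeasurableSet.iInter fun σ => ?_
      by_cases hT : V.T s = V.T σ
      · simp only [hT, true_imp_iff]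
        exact measurableSet_le (measurable_noiseTerm V γ Qs s σ a).abs measurable_const
      · simp [hT]
    · refine ae_all_iff.2 fun σ => ?_
      by_cases hT : V.T s = V.T σ
      · exact (ae_abs_noiseTerm_le V hγ Qs hR a hT).mono fun y hy _ => hy.trans hRK
      · exact Filter.Eventually.of_forall fun y hy => absurd hy hT
  have hsub : {ω | ‖qTable V c φ γ Q₀ (fun t => X t ω) (fun t => U t ω) (fun t => R t ω) τ - Qs‖
        ≤ ρ ^ J * (D + η) + η / (1 - ρ) + η}ᶜ
      ⊆ wᶜ ∪ ((⋃ j ∈ Finset.range (J + 1), E j) ∪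
        ⋃ t ∈ Finset.range (τ + 1), ⋃ σ ∈ (Finset.univ : Finset S),
          ⋃ a ∈ (Finset.univ : Finset A), F t σ a) := by
    intro ω hω
    by_contra hcon
    simp only [Set.mem_union, not_or, Set.mem_iUnion, not_exists, Finset.mem_range,
      Finset.mem_univ, true_imp_iff, Set.mem_compl_iff, not_not] at hcon
    obtain ⟨hcw, hcE, hcF⟩ := hcon
    refine hω (norm_qTable_sub_le_of_path V c hφ hγ hγ1 hD hη hN hcw hKD h0 hm ?_ ?_ hρ hρ1)
    · exact fun t ht σ a => (not_le.1 (hcF t (by omega) σ a)).le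
    · intro j hj σ a
      refine (not_lt.1 (hcE j (by omega))).trans (Nat.cast_le.2 ?_)
      refine (coverCount_le_card V.T _ _ _ _ _ σ a).trans (Finset.card_le_card
        (Finset.filter_subset_filter _ (Finset.Ico_subset_Ico_right ?_)))
      linarith [add_mul j 1 m]
  have hEm : μ (⋃ j ∈ Finset.range (J + 1), E j)
      ≤ ENNReal.ofReal ((J + 1) * Real.exp (-N)) := by
    refine (measure_biUnion_finset_le _ _).trans ((Finset.sum_le_sum fun j _ =>
      hcov.measure_coverCount_lt h hp hp1 (j * m) n).trans ?_)
    rw [Finset.sum_const, Finset.card_range, nsmul_eq_mul, ENNReal.ofReal_mul (by positivity)]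
    refine le_of_eq (congrArg (· * _) ?_)
    rw [← Nat.cast_add_one, ENNReal.ofReal_natCast]
  have hFm : μ (⋃ t ∈ Finset.range (τ + 1), ⋃ σ ∈ (Finset.univ : Finset S),
          ⋃ a ∈ (Finset.univ : Finset A), F t σ a)
      ≤ ENNReal.ofReal ((τ + 1) * (Fintype.card S * (Fintype.card A * (2 * (τ + 1)
          * Real.exp (-(η ^ 2 / (2 * K ^ 2) * N ^ φ)))))) := by
    have h1 : ∀ t ∈ Finset.range (τ + 1), ∀ σ a, μ (F t σ a) ≤ ENNReal.ofReal (2 * (τ + 1)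
        * Real.exp (-(η ^ 2 / (2 * K ^ 2) * N ^ φ))) := by
      intro t ht σ a
      refine (h.measure_le_abs_noiseAvg V c hφ (by positivity) hγ hQ hR hK hη hRK t σ a).trans
        (ENNReal.ofReal_le_ofReal ?_)
      have e : η ^ 2 / (2 * K ^ 2 * (1 / N ^ φ)) = η ^ 2 / (2 * K ^ 2) * N ^ φ := by
        field_simp
      rw [e]
      have : (t : ℝ) ≤ τ := by exact_mod_cast Nat.lt_succ_iff.1 (Finset.mem_range.1 ht)
      gcongr
    refine (measure_biUnion_finset_le _ _).trans ((Finset.sum_le_sum fun t ht =>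
      (measure_biUnion_finset_le _ _).trans (Finset.sum_le_sum fun σ _ =>
        (measure_biUnion_finset_le _ _).trans (Finset.sum_le_sum fun a _ => h1 t ht σ a))).trans ?_)
    simp only [Finset.sum_const, Finset.card_range, Finset.card_univ, nsmul_eq_mul]
    rw [ENNReal.ofReal_mul (p := (τ : ℝ) + 1) (by positivity),
      ENNReal.ofReal_mul (p := (Fintype.card S : ℝ)) (by positivity),
      ENNReal.ofReal_mul (p := (Fintype.card A : ℝ)) (by positivity), ENNReal.ofReal_natCast,
      ENNReal.ofReal_natCast, ← Nat.cast_add_one, ENNReal.ofReal_natCast]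
  refine (measure_mono hsub).trans ((measure_union_le _ _).trans ?_)
  rw [hwae, zero_add, ENNReal.ofReal_add (by positivity) (by positivity)]
  exact (measure_union_le _ _).trans (add_le_add hEm hFm)

/-! ### Choice of the constant -/

theorem eventually_add_log_le_rpow {e f c : ℝ} (he : 0 < e) (hef : e < f) (hc : 0 < c) (l G : ℝ) :
    ∀ᶠ x : ℝ in Filter.atTop, l * x ^ e + G + 2 * Real.log (x + 1) ≤ c * x ^ f := by
  have h1 : (fun x : ℝ => x ^ e) =o[Filter.atTop] fun x => x ^ f := by
    refine (Asymptotics.isLittleO_iff_tendsto' ?_).2 ?_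
    · filter_upwards [Filter.eventually_gt_atTop 0] with x hx hx0
      exact absurd hx0 (Real.rpow_pos_of_pos hx f).ne'
    · refine (tendsto_rpow_neg_atTop (sub_pos.2 hef)).congr' ?_
      filter_upwards [Filter.eventually_gt_atTop 0] with x hx
      rw [← Real.rpow_sub hx, neg_sub]
  have h2 : (fun _ : ℝ => G + 2) =o[Filter.atTop] fun x : ℝ => x ^ f :=
    Asymptotics.isLittleO_const_left.2 (Or.inr
      (tendsto_norm_atTop_atTop.comp (tendsto_rpow_atTop (he.trans hef))))
  have h3 := isLittleO_log_rpow_atTop (he.trans hef)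
  have h4 := ((h1.const_mul_left l).add h2).add (h3.const_mul_left 2)
  filter_upwards [h4.bound hc, Filter.eventually_ge_atTop 1] with x hx hx1
  have hlog : Real.log (x + 1) ≤ 1 + Real.log x := by
    have : Real.log (x + 1) ≤ Real.log (2 * x) := Real.log_le_log (by linarith) (by linarith)
    rw [Real.log_mul (by norm_num) (by linarith)] at this
    linarith [Real.log_two_lt_d9]
  rw [Real.norm_of_nonneg (Real.rpow_nonneg (by linarith) _)] at hx
  have := (le_abs_self _).trans hx
  linarith

/-- The constant: with `B * ℓ` the covering time and `N` a number of updates proportional to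
`τ / B`, the sum of the learning rates, the number of covered blocks and the reciprocal of the
learning rates all are as large as needed. -/
theorem exists_const_covering {φ : ℝ} (hφ : 0 < φ) (hφ1 : φ < 1) {b₀ ℓ₀ κ c Λ G H : ℝ}
    (hb₀ : 0 < b₀) (hℓ₀ : 0 < ℓ₀) (hκ : 0 < κ) (hc : 0 < c) (hG : 0 ≤ G) :
    ∃ C : ℝ, 0 < C ∧ ∀ B ℓ τ : ℝ, b₀ ≤ B → ℓ₀ ≤ ℓ →
      C * ((B * ℓ) ^ (3 + 1 / φ) + (B * ℓ) ^ (1 / (1 - φ))) ≤ τ →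
      1 ≤ τ ∧ H * B ≤ τ ∧ ∀ N : ℝ, κ * τ / B ≤ N →
        Λ ≤ N * (1 / τ ^ φ) ∧ ℓ + G ≤ N ∧ ℓ + G + 2 * Real.log (τ + 1) ≤ c * N ^ φ := by
  set e := 1 / (3 + 1 / φ) with he
  have he0 : 0 < e := by positivity
  have hee : e < (1 - e) * φ := by
    rw [he]; field_simp; nlinarith
  obtain ⟨τ₀, hτ₀⟩ := Filter.eventually_atTop.1 (eventually_add_log_le_rpow he0 hee
    (c := c * (κ * ℓ₀) ^ φ) (by positivity) b₀⁻¹ G)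
  set k₀ := b₀ * ℓ₀ with hk₀
  have hk₀0 : 0 < k₀ := by positivity
  set C₁ := max (max (Λ / (κ * ℓ₀)) ((1 + G / ℓ₀) / κ)) (max (H / ℓ₀) 1) with hC₁
  have hC₁1 : 1 ≤ C₁ := (le_max_right _ _).trans (le_max_right _ _)
  have hφ' : 0 < 1 - φ := by linarith
  set C := max (C₁ ^ (1 / (1 - φ))) (max 1 (max τ₀ 1 / k₀ ^ (1 / (1 - φ)))) with hC
  have hC1 : 1 ≤ C := (le_max_left _ _).trans (le_max_right _ _)
  refine ⟨C, by linarith, fun B ℓ τ hB hℓ hτ => ?_⟩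
  have hB0 : 0 < B := hb₀.trans_le hB
  have hℓ0 : 0 < ℓ := hℓ₀.trans_le hℓ
  set k := B * ℓ with hk
  have hk0 : 0 < k := by positivity
  have hkk : k₀ ≤ k := mul_le_mul hB hℓ hℓ₀.le hB0.le
  have hx1 : 0 < k ^ (3 + 1 / φ) := by positivity
  have hx2 : 0 < k ^ (1 / (1 - φ)) := by positivity
  have hC0 : 0 < C := by linarith
  have hτ1 : C * k ^ (3 + 1 / φ) ≤ τ := by nlinarith
  have hτ2 : C * k ^ (1 / (1 - φ)) ≤ τ := by nlinarith
  have hbig : max τ₀ 1 ≤ τ := by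
    refine le_trans ?_ hτ2
    have h1 : max τ₀ 1 / k₀ ^ (1 / (1 - φ)) ≤ C := (le_max_right _ _).trans (le_max_right _ _)
    rw [div_le_iff₀ (by positivity)] at h1
    exact h1.trans (mul_le_mul_of_nonneg_left (Real.rpow_le_rpow hk₀0.le hkk (by positivity)) hC0.le)
  have hτge1 : 1 ≤ τ := (le_max_right _ _).trans hbig
  have hτ0 : 0 < τ := by linarith
  have hpow : C₁ * k ≤ τ ^ (1 - φ) := by
    have h1 : (C₁ * k) ^ (1 / (1 - φ)) ≤ τ := by
      rw [Real.mul_rpow (by linarith) hk0.le]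
      exact (mul_le_mul_of_nonneg_right (le_max_left _ _) hx2.le).trans hτ2
    have h2 := Real.rpow_le_rpow (by positivity) h1 hφ'.le
    rwa [← Real.rpow_mul (by positivity), one_div_mul_cancel hφ'.ne', Real.rpow_one] at h2
  have hττ : τ ^ (1 - φ) ≤ τ := by
    simpa using Real.rpow_le_rpow_of_exponent_le hτge1 (by linarith : 1 - φ ≤ 1)
  have hc1 : Λ ≤ κ * C₁ * ℓ₀ := by
    have : Λ / (κ * ℓ₀) ≤ C₁ := (le_max_left _ _).trans (le_max_left _ _)
    rw [div_le_iff₀ (by positivity)] at this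
    linarith
  have hc2 : 1 + G / ℓ₀ ≤ κ * C₁ := by
    have : (1 + G / ℓ₀) / κ ≤ C₁ := (le_max_right _ _).trans (le_max_left _ _)
    rw [div_le_iff₀ hκ] at this
    linarith
  have hc3 : H ≤ C₁ * ℓ₀ := by
    have : H / ℓ₀ ≤ C₁ := (le_max_left _ _).trans (le_max_right _ _)
    rwa [div_le_iff₀ hℓ₀] at this
  have hke : k ≤ τ ^ e := by
    have h1 : k ^ (3 + 1 / φ) ≤ τ := by nlinarith
    have h2 := Real.rpow_le_rpow (by positivity) h1 he0.le
    rwa [← Real.rpow_mul hk0.le, he, mul_one_div_cancel (by positivity), Real.rpow_one] at h2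
  refine ⟨hτge1, ?_, fun N hN => ⟨?_, ?_, ?_⟩⟩
  · calc H * B ≤ C₁ * ℓ₀ * B := by gcongr
      _ ≤ C₁ * ℓ * B := by gcongr
      _ = C₁ * k := by rw [hk]; ring
      _ ≤ τ := hpow.trans hττ
  · have h1 : κ * τ / B * (1 / τ ^ φ) = κ * τ ^ (1 - φ) / B := by
      rw [Real.rpow_sub hτ0, Real.rpow_one]
      ring
    calc Λ ≤ κ * C₁ * ℓ := hc1.trans (by gcongr)
      _ = κ * (C₁ * k) / B := by rw [hk]; field_simp
      _ ≤ κ * τ ^ (1 - φ) / B := by gcongr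
      _ = κ * τ / B * (1 / τ ^ φ) := h1.symm
      _ ≤ N * (1 / τ ^ φ) := by gcongr
  · calc ℓ + G ≤ (1 + G / ℓ₀) * ℓ := by
          have : G ≤ G / ℓ₀ * ℓ := by
            rw [div_mul_eq_mul_div, le_div_iff₀ hℓ₀]; gcongr
          linarith
      _ ≤ κ * C₁ * ℓ := by gcongr
      _ = κ * (C₁ * k) / B := by rw [hk]; field_simp
      _ ≤ κ * τ / B := by have := hpow.trans hττ; gcongr
      _ ≤ N := hN
  · have h1 : ℓ ≤ b₀⁻¹ * τ ^ e := by
      have : ℓ = B⁻¹ * k := by rw [hk]; field_simp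
      rw [this]
      gcongr
    have h2 : κ * ℓ₀ * τ ^ (1 - e) ≤ N := by
      refine le_trans ?_ hN
      rw [le_div_iff₀ hB0, Real.rpow_sub hτ0, Real.rpow_one]
      have h3 : ℓ₀ * B ≤ τ ^ e := by
        refine le_trans ?_ hke
        rw [hk, mul_comm]; gcongr
      have h4 : 0 < τ ^ e := by positivity
      calc κ * ℓ₀ * (τ / τ ^ e) * B = κ * τ * (ℓ₀ * B / τ ^ e) := by ring
        _ ≤ κ * τ * 1 := by
          gcongr
          exact (div_le_one h4).2 h3
        _ = κ * τ := mul_one _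
    have h3 := hτ₀ τ ((le_max_left _ _).trans hbig)
    calc ℓ + G + 2 * Real.log (τ + 1) ≤ b₀⁻¹ * τ ^ e + G + 2 * Real.log (τ + 1) := by gcongr
      _ ≤ c * (κ * ℓ₀) ^ φ * τ ^ ((1 - e) * φ) := h3
      _ = c * (κ * ℓ₀ * τ ^ (1 - e)) ^ φ := by
        rw [Real.mul_rpow (x := κ * ℓ₀) (by positivity) (by positivity), Real.rpow_mul hτ0.le]
        ring
      _ ≤ c * N ^ φ := by gcongr

/-! ### Assembling the bound -/

theorem IsOptimalQ.norm_le {S A : Type*} [Fintype S] [MeasurableSpace S] [Fintype A] [Nonempty A]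
    {M : RewardMDP S A} {γ : ℝ} {Qs : S → A → ℝ} (hQ : IsOptimalQ M γ Qs) (hγ : 0 ≤ γ)
    (hγ1 : γ < 1) {r : ℝ} (hr : 0 ≤ r) (hR : ∀ s a, ∀ᵐ x ∂(M.law s a), |x.2| ≤ r) :
    ‖Qs‖ ≤ r / (1 - γ) := by
  have hp := M.isProb
  have h1 : ‖Qs‖ ≤ r + γ * ‖Qs‖ := by
    have h0 : 0 ≤ r + γ * ‖Qs‖ := by positivity
    refine (pi_norm_le_iff_of_nonneg h0).2 fun s => (pi_norm_le_iff_of_nonneg h0).2 fun a => ?_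
    rw [hQ s a]
    refine (norm_integral_le_of_norm_le_const (C := r + γ * ‖Qs‖) ?_).trans (by simp)
    filter_upwards [hR s a] with x hx
    refine (norm_add_le _ _).trans (add_le_add hx ?_)
    rw [norm_mul, Real.norm_of_nonneg hγ]
    exact mul_le_mul_of_nonneg_left (abs_rowMax_le Qs x.1) hγ
  rw [le_div_iff₀ (by linarith)]
  linarith

theorem batchSize_pos {S Z : Type*} [Fintype S] [Nonempty S] (T : S → Z) : 0 < batchSize T := by
  obtain ⟨s⟩ := ‹Nonempty S›
  have : Nonempty {σ : S // T σ = T s} := ⟨⟨s, rfl⟩⟩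
  exact Nat.card_pos.trans_le
    (Finset.le_sup (f := fun s => Nat.card {σ : S // T σ = T s}) (Finset.mem_univ s))

theorem CoversWithProb.length_pos {S A Z Ω : Type*} [Nonempty S] [Nonempty A]
    [mΩ : MeasurableSpace Ω] {T : S → Z} {μ : Measure Ω} [IsProbabilityMeasure μ]
    {ℱ : Filtration ℕ mΩ} {X : ℕ → Ω → S} {U : ℕ → Ω → A} {L : ℕ} {p : ℝ}
    (h : CoversWithProb T μ ℱ X U L p) (hp : 0 < p) : 0 < L := by
  obtain ⟨s⟩ := ‹Nonempty S›
  obtain ⟨a⟩ := ‹Nonempty A›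
  refine Nat.pos_of_ne_zero fun hL => ?_
  have h0 := h 0 Set.univ MeasurableSet.univ
  have he : coverEvent T X U 0 L = ∅ := by
    refine Set.eq_empty_of_forall_notMem fun ω hω => ?_
    obtain ⟨k, h1, h2, -⟩ := hω s a
    omega
  rw [he, Set.inter_empty, measure_empty, measure_univ, mul_one] at h0
  exact hp.not_ge (ENNReal.ofReal_eq_zero.1 (le_antisymm h0 bot_le))

theorem coveringTime_eq (L : ℕ) (δ p : ℝ) :
    coveringTime L δ p = L / -Real.log (1 - p) * -Real.log δ := by
  have : Real.log 2 ≠ 0 := (Real.log_pos (by norm_num)).ne'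
  rw [coveringTime, Real.logb, Real.logb, div_div_div_cancel_right₀ this, div_mul_eq_mul_div,
    mul_neg, neg_div_neg_eq, mul_div_assoc]

theorem one_sub_mul_neg_log_le {p p₁ : ℝ} (hp : 0 ≤ p) (hpp : p ≤ p₁) (hp₁ : p₁ < 1) :
    (1 - p₁) * -Real.log (1 - p) ≤ p := by
  have h0 : Real.log (1 - p) ≤ 0 := Real.log_nonpos (by linarith) (by linarith)
  have h1 := Real.one_sub_inv_le_log_of_pos (by linarith : 0 < 1 - p)
  have h2 : (1 - p) * -Real.log (1 - p) ≤ (1 - p) * ((1 - p)⁻¹ - 1) :=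
    mul_le_mul_of_nonneg_left (by linarith) (by linarith)
  rw [mul_sub, mul_inv_cancel₀ (by linarith)] at h2
  have h3 : (1 - p₁) * -Real.log (1 - p) ≤ (1 - p) * -Real.log (1 - p) :=
    mul_le_mul_of_nonneg_right (by linarith) (by linarith)
  linarith

/-- `J + 1` phases of equal length, together at most `τ`, have room for at least `τ / (2 (J + 1) L)`
blocks of length `L` each: rounding down costs at most a factor of two. -/
theorem exists_phases_blocks {J L τ : ℕ} (hL : 0 < L) (h : (J + 1) * L ≤ τ) :
    ∃ m n : ℕ, (J + 1) * m ≤ τ ∧ n * L ≤ m ∧ (τ : ℝ) ≤ 2 * ((J + 1) * L) * n := by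
  have hd : 0 < (J + 1) * L := by positivity
  refine ⟨τ / (J + 1), τ / ((J + 1) * L), Nat.mul_div_le _ _, ?_, ?_⟩
  · rw [← Nat.div_div_eq_div_mul]
    exact Nat.div_mul_le_self _ _
  · have h1 : 1 ≤ τ / ((J + 1) * L) := (Nat.one_le_div_iff hd).2 h
    have h2 : τ < (J + 1) * L * (τ / ((J + 1) * L) + 1) := Nat.lt_mul_div_succ τ hd
    have h3 : τ ≤ 2 * ((J + 1) * L) * (τ / ((J + 1) * L)) := by nlinarith
    exact_mod_cast h3

/-- The error probability is at most `δ` if both exponents exceed `log (1 / δ)` by enough to absorb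
the factors of the union bound. -/
theorem error_prob_le {J s a δ τ W N N' : ℝ} (hJ : 1 ≤ J) (hs : 1 ≤ s) (ha : 1 ≤ a)
    (hδ : 0 < δ) (hτ : 0 ≤ τ) (hW : W = 4 * J * (s * a)) (hN : -Real.log δ + Real.log W ≤ N)
    (hN' : -Real.log δ + Real.log W + 2 * Real.log (τ + 1) ≤ N') :
    J * Real.exp (-N) + (τ + 1) * (s * (a * (2 * (τ + 1) * Real.exp (-N')))) ≤ δ := by
  have hW0 : 0 < W := by rw [hW]; positivity
  have hsa : 1 ≤ s * a := one_le_mul_of_one_le_of_one_le hs ha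
  have hlogδ : Real.exp (-(-Real.log δ + Real.log W)) = δ / W := by
    rw [neg_add, neg_neg, Real.exp_add, Real.exp_neg, Real.exp_log hδ, Real.exp_log hW0]
    rfl
  have h1 : J * Real.exp (-N) ≤ δ / 2 := by
    calc J * Real.exp (-N) ≤ J * (δ / W) := by
          rw [← hlogδ]; gcongr
      _ = δ / 4 / (s * a) := by rw [hW]; field_simp
      _ ≤ δ / 4 := div_le_self (by positivity) hsa
      _ ≤ δ / 2 := by linarith
  have h2 : Real.exp (-N') ≤ δ / W / (τ + 1) ^ 2 := by
    have h3 : Real.exp (-(2 * Real.log (τ + 1))) = ((τ + 1) ^ 2)⁻¹ := by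
      rw [Real.exp_neg, two_mul, Real.exp_add, Real.exp_log (by positivity), sq]
    rw [div_eq_mul_inv (δ / W), ← hlogδ, ← h3, ← Real.exp_add]
    exact Real.exp_le_exp.2 (by linarith)
  have h4 : (τ + 1) * (s * (a * (2 * (τ + 1) * Real.exp (-N')))) ≤ δ / 2 := by
    calc (τ + 1) * (s * (a * (2 * (τ + 1) * Real.exp (-N'))))
        ≤ (τ + 1) * (s * (a * (2 * (τ + 1) * (δ / W / (τ + 1) ^ 2)))) := by gcongr
      _ = δ / 2 / J := by rw [hW]; field_simp; ring
      _ ≤ δ / 2 := div_le_self (by positivity) hJ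
  linarith

/-- The number of covered blocks guaranteed up to small probability, in terms of `L / lam`. -/
theorem mul_div_covering_le {j L τ n p p₁ lam : ℝ} (hj : 0 < j) (hL : 0 < L) (hlam : 0 < lam)
    (hτ : 0 ≤ τ) (hp₁ : p₁ < 1) (hp : (1 - p₁) * lam ≤ p) (hn : τ ≤ 2 * (j * L) * n) :
    (1 - p₁) / (8 * j) * τ / (L / lam) ≤ n * p / 4 := by
  have hp0 : 0 ≤ p := (mul_nonneg (by linarith) hlam.le).trans hp
  calc (1 - p₁) / (8 * j) * τ / (L / lam) = (1 - p₁) * lam / (8 * (j * L)) * τ := by field_simp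
    _ ≤ p / (8 * (j * L)) * (2 * (j * L) * n) := by gcongr
    _ = n * p / 4 := by field_simp; ring

end VirtualQ

open VirtualQ in
theorem mainTheorem2 {S A : Type*} [Fintype S] [Nonempty S] [MeasurableSpace S]
    [MeasurableSingletonClass S] [Fintype A] [Nonempty A] [MeasurableSpace A]
    [MeasurableSingletonClass A] (φ γ ε Rmax q δ₀ p₀ : ℝ)
    (hφ : 1 / 2 < φ) (hφ1 : φ < 1) (hγ : 0 ≤ γ) (hγ1 : γ < 1) (hε : 0 < ε)
    (hδ₀ : δ₀ < 1) (hp₀ : p₀ < 1) :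
    ∃ C : ℝ, 0 < C ∧
      ∀ (M : VirtualQ.RewardMDP S A),
        (∀ s a, ∀ᵐ x ∂(M.law s a), |x.2| ≤ Rmax) →
      ∀ (Qstar : S → A → ℝ), VirtualQ.IsOptimalQ M γ Qstar →
      ∀ (Z : Type*) (V : VirtualQ.VirtualExperience M Z) (c : VirtualQ.Clock) (Q₀ : S → A → ℝ),
        (∀ s a, |Q₀ s a| ≤ q) →
      ∀ (Ω : Type*) [mΩ : MeasurableSpace Ω] (μ : Measure Ω) [IsProbabilityMeasure μ]
        (ℱ : Filtration ℕ mΩ) (X : ℕ → Ω → S) (U : ℕ → Ω → A) (R : ℕ → Ω → ℝ),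
        VirtualQ.IsTrajectory M μ ℱ X U R →
      ∀ (L : ℕ) (P δ : ℝ), 0 < P → (VirtualQ.batchSize V.T : ℝ) * P ≤ p₀ →
        VirtualQ.CoversWithProb V.T μ ℱ X U L ((VirtualQ.batchSize V.T : ℝ) * P) →
        0 < δ → δ ≤ δ₀ →
      ∀ τ : ℕ,
        C * ((VirtualQ.coveringTime L δ ((VirtualQ.batchSize V.T : ℝ) * P)) ^ (3 + 1 / φ)
          + (VirtualQ.coveringTime L δ ((VirtualQ.batchSize V.T : ℝ) * P)) ^ (1 / (1 - φ))) ≤ τ →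
        ENNReal.ofReal (1 - δ) ≤
          μ {ω | ‖VirtualQ.qTable V c φ γ Q₀ (fun t => X t ω) (fun t => U t ω)
            (fun t => R t ω) τ - Qstar‖ ≤ ε} := by
  have hγ' : 0 < 1 - γ := by linarith
  have hφ0 : 0 < φ := by linarith
  -- the maxima provide positive constants also where `q`, `Rmax`, `δ₀`, `p₀` are not positive
  set δ₁ := max δ₀ (1 / 2) with hδ₁
  set p₁ := max p₀ (1 / 2) with hp₁
  have hδ₀₁ : δ₀ ≤ δ₁ := le_max_left _ _
  have hp₀₁ : p₀ ≤ p₁ := le_max_left _ _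
  have hδ₁1 : δ₁ < 1 := max_lt hδ₀ (by norm_num)
  have hδ₁0 : 0 < δ₁ := lt_max_of_lt_right (by norm_num)
  have hp₁1 : p₁ < 1 := max_lt hp₀ (by norm_num)
  have hp₁0 : 0 < p₁ := lt_max_of_lt_right (by norm_num)
  set ℓ₀ := -Real.log δ₁ with hℓ₀
  have hℓ₀0 : 0 < ℓ₀ := neg_pos.2 (Real.log_neg hδ₁0 hδ₁1)
  set lam₀ := -Real.log (1 - p₁) with hlam₀
  have hlam₀0 : 0 < lam₀ := neg_pos.2 (Real.log_neg (by linarith) (by linarith))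
  set r := max Rmax 0 with hr
  have hr0 : 0 ≤ r := le_max_right _ _
  have hRr : Rmax ≤ r := le_max_left _ _
  clear_value δ₁ p₁ r
  set K := r + (1 + γ) * (r / (1 - γ)) + 1 with hK
  have hK0 : 0 < K := by positivity
  set D := max q 0 + r / (1 - γ) + K / (1 - γ) with hD
  have hD0 : 0 ≤ D := by
    have : 0 ≤ max q 0 := le_max_right _ _
    positivity
  set η := ε * (1 - γ) / 8 with hη
  have hη0 : 0 < η := by positivity
  set ρ := (1 + γ) / 2 with hρ
  have hρ1 : ρ < 1 := by rw [hρ]; linarith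
  have hρ0 : 0 ≤ ρ := by positivity
  obtain ⟨J, hJ⟩ := exists_pow_lt_of_lt_one (x := ε / 2 / (D + η)) (by positivity) hρ1
  rw [lt_div_iff₀ (by positivity)] at hJ
  have hcS : (1 : ℝ) ≤ Fintype.card S := by exact_mod_cast Fintype.card_pos (α := S)
  have hcA : (1 : ℝ) ≤ Fintype.card A := by exact_mod_cast Fintype.card_pos (α := A)
  set W : ℝ := 4 * (J + 1) * (Fintype.card S * Fintype.card A) with hW
  have hcSA : (1 : ℝ) ≤ Fintype.card S * Fintype.card A := one_le_mul_of_one_le_of_one_le hcS hcA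
  have hJ1 : (1 : ℝ) ≤ J + 1 := by linarith [(Nat.cast_nonneg J : (0 : ℝ) ≤ J)]
  have hW1 : 1 ≤ W := by
    have := one_le_mul_of_one_le_of_one_le hJ1 hcSA
    rw [hW]; linarith
  clear_value ℓ₀ lam₀ K D η ρ W
  obtain ⟨C, hC0, hC⟩ := exists_const_covering hφ0 hφ1 (b₀ := lam₀⁻¹) (ℓ₀ := ℓ₀)
    (κ := (1 - p₁) / (8 * (J + 1))) (c := η ^ 2 / (2 * K ^ 2)) (Λ := Real.log (2 / (1 - γ)))
    (G := Real.log W) (H := (J + 1) * lam₀) (by positivity) hℓ₀0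
    (div_pos (by linarith) (by positivity)) (by positivity) (Real.log_nonneg hW1)
  refine ⟨C, hC0, ?_⟩
  intro M hR Qstar hQ Z V c Q₀ hQ₀ Ω mΩ μ _ ℱ X U R h L P δ hP hPp₀ hcov hδ hδδ₀ τ hτ
  set p := (batchSize V.T : ℝ) * P with hp
  have hp0 : 0 < p := mul_pos (by exact_mod_cast batchSize_pos V.T) hP
  have hpp₁ : p ≤ p₁ := hPp₀.trans hp₀₁
  have hL : 0 < L := hcov.length_pos hp0
  have hL1 : (1 : ℝ) ≤ L := by exact_mod_cast hL
  set lam := -Real.log (1 - p) with hlam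
  have hlam0 : 0 < lam := neg_pos.2 (Real.log_neg (by linarith) (by linarith))
  have hlamle : lam ≤ lam₀ := hlam₀ ▸ neg_le_neg (Real.log_le_log (by linarith) (by linarith))
  have hlamp : (1 - p₁) * lam ≤ p := one_sub_mul_neg_log_le hp0.le hpp₁ hp₁1
  have hℓ : ℓ₀ ≤ -Real.log δ :=
    hℓ₀ ▸ neg_le_neg (Real.log_le_log hδ (hδδ₀.trans hδ₀₁))
  have hB : lam₀⁻¹ ≤ L / lam := by
    rw [inv_eq_one_div]
    exact div_le_div₀ (by positivity) hL1 hlam0 hlamle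
  rw [coveringTime_eq, ← hlam] at hτ
  clear_value p lam
  obtain ⟨hτ1, hτL, hN⟩ := hC (L / lam) (-Real.log δ) τ hB hℓ hτ
  have hdτ : (J + 1) * L ≤ τ := by
    have h1 : ((J : ℝ) + 1) * L ≤ (J + 1) * lam₀ * (L / lam) := by
      rw [mul_assoc]
      refine mul_le_mul_of_nonneg_left ?_ (by positivity)
      rw [← mul_div_assoc, le_div_iff₀ hlam0, mul_comm]
      exact mul_le_mul_of_nonneg_right hlamle (by positivity)
    exact_mod_cast h1.trans hτL
  obtain ⟨m, n, hm, hnm, hnτ⟩ := exists_phases_blocks hL hdτ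
  have hNn : (1 - p₁) / (8 * (J + 1)) * τ / (L / lam) ≤ n * p / 4 :=
    mul_div_covering_le (by positivity) (by positivity) hlam0 (by positivity) hp₁1 hlamp hnτ
  obtain ⟨hΛ, hN1, hN2⟩ := hN _ hNn
  have hN0 : 0 < n * p / 4 := by linarith [Real.log_nonneg hW1]
  have hexpΛ : γ + Real.exp (-(n * p / 4 * (1 / (τ : ℝ) ^ φ))) ≤ ρ := by
    have h1 := Real.exp_le_exp.2 (neg_le_neg hΛ)
    rw [Real.exp_neg (Real.log _), Real.exp_log (by positivity), inv_div] at h1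
    rw [hρ]; linarith
  have hRr' : ∀ s a, ∀ᵐ x ∂(M.law s a), |x.2| ≤ r := fun s a =>
    (hR s a).mono fun x hx => hx.trans hRr
  have hQn : ‖Qstar‖ ≤ r / (1 - γ) := hQ.norm_le hγ hγ1 hr0 hRr'
  have hKD : K ≤ (1 - γ) * D := by
    have h1 : (1 - γ) * (K / (1 - γ)) = K := mul_div_cancel₀ _ hγ'.ne'
    have h2 : 0 ≤ (1 - γ) * (max q 0 + r / (1 - γ)) :=
      mul_nonneg hγ'.le (add_nonneg (le_max_right _ _) (by positivity))
    rw [hD, mul_add, h1]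
    linarith
  have h0 : ∀ σ a, |Q₀ σ a - Qstar σ a| ≤ D := by
    intro σ a
    have h1 : |Qstar σ a| ≤ ‖Qstar‖ := (norm_le_pi_norm (Qstar σ) a).trans (norm_le_pi_norm Qstar σ)
    have h2 : |Q₀ σ a| ≤ max q 0 := (hQ₀ σ a).trans (le_max_left _ _)
    have h3 : 0 ≤ K / (1 - γ) := by positivity
    refine (abs_sub _ _).trans ?_
    rw [hD]; linarith
  have hRK : r + (1 + γ) * ‖Qstar‖ ≤ K := by
    have := mul_le_mul_of_nonneg_left hQn (by linarith : 0 ≤ 1 + γ)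
    rw [hK]; linarith
  have hmain := h.measure_compl_norm_le V c hφ0.le hγ hγ1 hQ hRr' hK0 hD0 hη0.le hRK hKD h0
    hm hnm hp0.le (by linarith) hcov hN0 hexpΛ hρ1
  have hbound : ρ ^ J * (D + η) + η / (1 - ρ) + η ≤ ε := by
    have h1 : η / (1 - ρ) = ε / 4 := by
      have : 1 - ρ = (1 - γ) / 2 := by rw [hρ]; ring
      rw [this, hη]; field_simp; ring
    have h2 : η ≤ ε / 8 := by rw [hη]; linarith [mul_nonneg hε.le hγ]
    linarith
  have hprob : (J + 1) * Real.exp (-(n * p / 4)) + (τ + 1) * (Fintype.card S * (Fintype.card A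
      * (2 * (τ + 1) * Real.exp (-(η ^ 2 / (2 * K ^ 2) * (n * p / 4) ^ φ))))) ≤ δ :=
    error_prob_le hJ1 hcS hcA hδ (by positivity) hW hN1 hN2
  set good : Set Ω := {ω | ‖qTable V c φ γ Q₀ (fun t => X t ω) (fun t => U t ω)
    (fun t => R t ω) τ - Qstar‖ ≤ ε} with hgood
  have hcompl : μ goodᶜ ≤ ENNReal.ofReal δ := by
    refine (measure_mono (Set.compl_subset_compl.2 fun ω hω => ?_)).trans
      (hmain.trans (ENNReal.ofReal_le_ofReal hprob))
    exact le_trans hω hbound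
  -- subadditivity suffices here, so measurability of the event is not needed
  have hone : (1 : ENNReal) ≤ μ good + μ goodᶜ := by
    rw [← measure_univ (μ := μ), ← Set.union_compl_self good]
    exact measure_union_le _ _
  rw [ENNReal.ofReal_sub _ hδ.le, ENNReal.ofReal_one, tsub_le_iff_right]
  exact hone.trans (add_le_add_right hcompl _)
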